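/- Let $d\in\mathbb N$ and $T>0$. Let $\Gamma$ be the space of curves $\gamma\in L^2((-1,T);\mathbb R^d)$ that are affine on $(-1,0)$, with the $L^2$ metric and its Borel $\sigma$-algebra; $\gamma(0)$ and $\gamma(-1)$ denote the end point values of the affine part, and $W_0(\gamma)=\gamma(0)-\gamma(-1)$, $e_0(\gamma)=\gamma(0)$. Let $\mathcal M(\Gamma)$ be the set of Borel probability measures $\eta$ on $\Gamma$ with $$\int|\gamma(0)|^2\,\eta(d\gamma)\le 1,\qquad \int\|\dot\gamma\|^2_{L^2(-1,T)}\,\eta(d\gamma)\le 1+T,$$ where $\dot\gamma$ is the weak derivative and $\|\dot\gamma\|_{L^2}=\infty$ if $\gamma\notin W^{1,2}((-1,T);\mathbb R^d)$. For $0<t<T$ let $T_t(\gamma)=\gamma|_{(t,T)}\in L^2((t,T);\mathbb R^d)$, let $(\omega^t_{\gamma'})$ be the disintegration of $\eta$ with respect to $T_t$, and put $V_t(\gamma)=\int W_0(\gamma')\,\omega^t_{T_t(\gamma)}(d\gamma')$. A measure $\eta\in\mathcal M(\Gamma)$ is a dissipative solution if $\dot\gamma(t)=V_t(\gamma)$ for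 almost every $t\in[0,T]$ and $\eta$-almost every $\gamma$; its initial datum is $\nu_0=(e_0,W_0)_\#\eta$, and its total dissipation is $$D(\eta)=T\int|W_0(\gamma)|^2\,\eta(d\gamma)-\int_0^T\!\!\int|V_t(\gamma)|^2\,\eta(d\gamma)\,dt .$$ A dissipative solution is a free flow if it is concentrated on a set of straight lines no two of which are at the same point at the same time $t\in[0,T)$. Let $\mathcal P_{2,1}$ be the set of Borel probability measures $\nu_0$ on $\mathbb R^d\times\mathbb R^d$ with $\int|x|^2\,d\nu_0\le1$ and $\int|v|^2\,d\nu_0\le1$, and let $D_0$ be the set of $\nu_0\in\mathcal P_{2,1}$ such that $D(\eta)=0$ for every dissipative solution $\eta\in\mathcal M(\Gamma)$ with initial datum $\nu_0$. If $\nu_0\in D_0$, then there are a Borel set $A\subset\mathbb R^d$ and a Borel map $v_0:\mathbb R^d\to\mathbb R^d$ such that $\nu_0$ is concentrated on the graph $\{(x_0,v_0(x_0)):x_0\in A\}$ and such that the straight lines $t\mapsto x_0+t\,v_0(x_0)$, $x_0\in A$, do not intersect during $[0,T)$, that is, $x_0+t\,v_0(x_0)\ne x_0'+t\,v_0(x_0')$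 for all $x_0\ne x_0'$ in $A$ and all $t\in[0,T)$. Moreover there is exactly one dissipative solution $\eta\in\mathcal M(\Gamma)$ with initial datum $\nu_0$, and it is the free flow concentrated on these straight lines. -/

import Mathlib

open MeasureTheory ProbabilityTheory Set
open scoped ENNReal ContDiff

namespace PressurelessEuler

noncomputable section

/-- The space `ℝ^d` with its Euclidean norm. -/
abbrev E (d : ℕ) : Type := EuclideanSpace ℝ (Fin d)

/-- Lebesgue measure on the time interval `(-1, T)`. -/
abbrev timeMeasure (T : ℝ) : Measure ℝ := volume.restrict (Ioo (-1) T)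

/-- `L²((-1, T), ℝ^d)`. -/
abbrev L2Curve (d : ℕ) (T : ℝ) : Type := Lp (E d) 2 (timeMeasure T)

/-- Curves of `L²((-1, T), ℝ^d)` whose restriction to `(-1, 0)` is affine, as a linear subspace. -/
def affineStart (d : ℕ) (T : ℝ) : Submodule ℝ (L2Curve d T) where
  carrier := {γ | ∃ p : E d × E d,
    ∀ᵐ t ∂((timeMeasure T).restrict (Ioo (-1) 0)), γ t = p.1 + t • p.2}
  zero_mem' := by
    refine ⟨0, ?_⟩
    filter_upwards [ae_restrict_of_ae (Lp.coeFn_zero (E d) 2 (timeMeasure T))] with t ht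
    rw [ht]
    simp
  add_mem' := by
    rintro γ γ' ⟨p, hp⟩ ⟨q, hq⟩
    refine ⟨p + q, ?_⟩
    filter_upwards [hp, hq, ae_restrict_of_ae (Lp.coeFn_add γ γ')] with t h1 h2 h3
    rw [h3, Pi.add_apply, h1, h2, Prod.fst_add, Prod.snd_add, smul_add]
    abel
  smul_mem' := by
    rintro c γ ⟨p, hp⟩
    refine ⟨c • p, ?_⟩
    filter_upwards [hp, ae_restrict_of_ae (Lp.coeFn_smul c γ)] with t h1 h3
    rw [h3, Pi.smul_apply, h1, Prod.smul_fst, Prod.smul_snd, smul_add, smul_comm]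

/-- The space of curves `Γ`, with the `L²((-1, T))` metric. -/
abbrev Curve (d : ℕ) (T : ℝ) : Type := affineStart d T

/-- The Borel `σ`-algebra of `Γ`. -/
instance instMeasurableSpaceCurve (d : ℕ) (T : ℝ) : MeasurableSpace (Curve d T) := borel _

instance instBorelSpaceCurve (d : ℕ) (T : ℝ) : BorelSpace (Curve d T) := ⟨rfl⟩

lemma memLp_affine {d : ℕ} (T : ℝ) (p : E d × E d) :
    MemLp (fun t : ℝ => p.1 + t • p.2) 2 ((timeMeasure T).restrict (Ioo (-1) 0)) := by
  refine MemLp.of_bound (by fun_prop) (‖p.1‖ + ‖p.2‖) ?_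
  filter_upwards [ae_restrict_mem measurableSet_Ioo] with t ht
  refine (norm_add_le _ _).trans ?_
  rw [norm_smul]
  have h1 : ‖t‖ ≤ 1 := by
    rw [Real.norm_eq_abs, abs_le]
    exact ⟨ht.1.le, by linarith [ht.2]⟩
  nlinarith [norm_nonneg p.2, norm_nonneg t]

lemma isClosed_affineStart (d : ℕ) (T : ℝ) : IsClosed (affineStart d T : Set (L2Curve d T)) := by
  let L : (E d × E d) →ₗ[ℝ] Lp (E d) 2 ((timeMeasure T).restrict (Ioo (-1) 0)) :=
    { toFun := fun p => (memLp_affine T p).toLp _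
      map_add' := by
        intro p q
        rw [← MemLp.toLp_add]
        refine MemLp.toLp_congr _ _ (Filter.Eventually.of_forall fun t => ?_)
        simp only [Pi.add_apply, Prod.fst_add, Prod.snd_add, smul_add]
        abel
      map_smul' := by
        intro c p
        rw [RingHom.id_apply, ← MemLp.toLp_const_smul]
        refine MemLp.toLp_congr _ _ (Filter.Eventually.of_forall fun t => ?_)
        simp only [Pi.smul_apply, Prod.smul_fst, Prod.smul_snd, smul_add]
        rw [smul_comm] }
  have hcl : IsClosed (L.range : Set (Lp (E d) 2 ((timeMeasure T).restrict (Ioo (-1) 0)))) :=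
    Submodule.closed_of_finiteDimensional _
  have h := hcl.preimage (LpToLpRestrictCLM ℝ (E d) ℝ (timeMeasure T) 2 (Ioo (-1) 0)).continuous
  convert h using 1
  ext γ
  simp only [mem_preimage, SetLike.mem_coe, LinearMap.mem_range]
  refine exists_congr fun p => ?_
  have hr := LpToLpRestrictCLM_coeFn (p := 2) (μ := timeMeasure T) ℝ (Ioo (-1) 0) γ
  have hp := (memLp_affine T p).coeFn_toLp
  constructor
  · intro h
    refine Lp.ext ?_
    exact hp.trans ((Filter.EventuallyEq.symm h).trans hr.symm)
  · intro h
    have h' : (memLp_affine T p).toLp _ =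
      LpToLpRestrictCLM ℝ (E d) ℝ (timeMeasure T) 2 (Ioo (-1) 0) γ := h
    rw [← h'] at hr
    exact hr.symm.trans hp

instance instCompleteSpaceCurve (d : ℕ) (T : ℝ) : CompleteSpace (Curve d T) :=
  (isClosed_affineStart d T).completeSpace_coe

instance instSecondCountableL2 (d : ℕ) (μ : Measure ℝ) [SigmaFinite μ] :
    SecondCountableTopology (Lp (E d) 2 μ) :=
  haveI : Fact ((2 : ℝ≥0∞) ≠ ⊤) := ⟨by norm_num⟩
  inferInstance

instance instStandardBorelSpaceCurve (d : ℕ) (T : ℝ) : StandardBorelSpace (Curve d T) :=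
  inferInstance

/-- The affine function of time that a curve of `Γ` equals on `(-1, 0)`; by its values at the end
points one defines `γ(0)` and `γ(-1)`. If `γ` is in `W^{1,2}` these are the values of its
continuous representative. -/
def initialAffine {d : ℕ} {T : ℝ} (γ : Curve d T) (t : ℝ) : E d :=
  (Classical.choose γ.2).1 + t • (Classical.choose γ.2).2

/-- The initial position `γ(0)`. -/
def e₀ {d : ℕ} {T : ℝ} (γ : Curve d T) : E d := initialAffine γ 0

/-- The initial velocity `W₀(γ) = γ(0) - γ(-1)`. -/
def W₀ {d : ℕ} {T : ℝ} (γ : Curve d T) : E d := initialAffine γ 0 - initialAffine γ (-1)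

/-- `g` is the weak derivative of `f` on `(-1, T)`. -/
def HasWeakDeriv {d : ℕ} (T : ℝ) (f g : ℝ → E d) : Prop :=
  ∀ φ : ℝ → ℝ, ContDiff ℝ ∞ φ → HasCompactSupport φ → tsupport φ ⊆ Ioo (-1) T →
    ∫ t in Ioo (-1) T, deriv φ t • f t = -∫ t in Ioo (-1) T, φ t • g t

/-- `‖γ̇‖²` in `L²((-1, T))`, with value `∞` if `γ` is not in `W^{1,2}((-1, T))`. -/
def energy {d : ℕ} {T : ℝ} (γ : Curve d T) : ℝ≥0∞ :=
  ⨅ (g : L2Curve d T) (_ : HasWeakDeriv T (γ : L2Curve d T) g), ‖g‖ₑ ^ 2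

/-- The set `𝓜(Γ)` of measures on curves with bounded second moment and energy. -/
def finiteEnergyMeasures (d : ℕ) (T : ℝ) : Set (ProbabilityMeasure (Curve d T)) :=
  {η | ∫⁻ γ, ‖e₀ γ‖ₑ ^ 2 ∂(η : Measure (Curve d T)) ≤ 1 ∧
    ∫⁻ γ, energy γ ∂(η : Measure (Curve d T)) ≤ 1 + ENNReal.ofReal T}

/-- The space `Γ_t = L²((t, T), ℝ^d)` of final parts of curves, for `0 < t < T`
(Lebesgue measure on `(t, T)` is written as a restriction of that on `(-1, T)`). -/
abbrev TailCurve (d : ℕ) (T t : ℝ) : Type := Lp (E d) 2 ((timeMeasure T).restrict (Ioo t T))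

instance instMeasurableSpaceTail (d : ℕ) (T t : ℝ) : MeasurableSpace (TailCurve d T t) := borel _

instance instBorelSpaceTail (d : ℕ) (T t : ℝ) : BorelSpace (TailCurve d T t) := ⟨rfl⟩

/-- The restriction map `T_t : Γ → Γ_t`. -/
def tail {d : ℕ} {T : ℝ} (t : ℝ) (γ : Curve d T) : TailCurve d T t :=
  LpToLpRestrictCLM ℝ (E d) ℝ (timeMeasure T) 2 (Ioo t T) (γ : L2Curve d T)

/-- The disintegration `ω^t` of `η` with respect to `T_t`: a Markov kernel from `Γ_t` to `Γ`. -/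
def disintegration {d : ℕ} {T : ℝ} (η : ProbabilityMeasure (Curve d T)) (t : ℝ) :
    Kernel (TailCurve d T t) (Curve d T) :=
  condDistrib id (tail t) (η : Measure (Curve d T))

/-- `V_t(γ) = ∫ W₀(γ') ω^t_{T_t(γ)}(dγ')`. -/
def V {d : ℕ} {T : ℝ} (η : ProbabilityMeasure (Curve d T)) (t : ℝ) (γ : Curve d T) : E d :=
  ∫ γ', W₀ γ' ∂(disintegration η t (tail t γ))

/-- `u` is a jointly measurable version of the map `(t, γ) ↦ γ̇(t)`, where for `η`-almost every
`γ` the derivative `γ̇` exists in `L²((-1, T))` in the weak sense. It is unique up to a null set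
of `𝓛¹ × η`. -/
def IsVelocity {d : ℕ} {T : ℝ} (η : ProbabilityMeasure (Curve d T)) (u : ℝ → Curve d T → E d) :
    Prop :=
  Measurable (Function.uncurry u) ∧
    ∀ᵐ (γ : Curve d T) ∂(η : Measure (Curve d T)), MemLp (fun t => u t γ) 2 (timeMeasure T) ∧
      HasWeakDeriv T (γ : L2Curve d T) (fun t => u t γ)

/-- Dissipative solutions: `γ̇(t) = V_t(γ)` almost everywhere on `[0, T] × Γ`. The map `V_t` is
determined up to an `η`-null set for every `t`, so "almost everywhere" is read, as in
Fubini's theorem, as "for almost every `t`, for `η`-almost every `γ`". -/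
def IsDissipative {d : ℕ} {T : ℝ} (η : ProbabilityMeasure (Curve d T)) : Prop :=
  η ∈ finiteEnergyMeasures d T ∧
    ∃ u : ℝ → Curve d T → E d, IsVelocity η u ∧
      ∀ᵐ t ∂(volume.restrict (Icc 0 T)), ∀ᵐ γ ∂(η : Measure (Curve d T)), u t γ = V η t γ

/-- The total dissipation `D(η) = T ‖W₀‖² - ∫₀ᵀ ∫ |V_t(γ)|² η(dγ) dt`. -/
def dissipation {d : ℕ} {T : ℝ} (η : ProbabilityMeasure (Curve d T)) : ℝ :=
  T * (∫ γ, ‖W₀ γ‖ ^ 2 ∂(η : Measure (Curve d T))) -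
    ∫ t in (0 : ℝ)..T, ∫ γ, ‖V η t γ‖ ^ 2 ∂(η : Measure (Curve d T))

/-- `η` has the initial datum `ν₀`, i.e. `ν₀` is the image of `η` under `(e₀, W₀)`. -/
def HasInitialDatum {d : ℕ} {T : ℝ} (η : ProbabilityMeasure (Curve d T))
    (ν₀ : ProbabilityMeasure (E d × E d)) : Prop :=
  (η : Measure (Curve d T)).map (fun γ => (e₀ γ, W₀ γ)) = ν₀

/-- Initial data with second moments of position and of velocity at most `1`. -/
def P₂₁ (d : ℕ) : Set (ProbabilityMeasure (E d × E d)) :=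
  {ν | ∫⁻ p, ‖p.1‖ₑ ^ 2 ∂(ν : Measure (E d × E d)) ≤ 1 ∧
    ∫⁻ p, ‖p.2‖ₑ ^ 2 ∂(ν : Measure (E d × E d)) ≤ 1}

/-- Initial data from which every dissipative solution has zero dissipation. -/
def D₀ (d : ℕ) (T : ℝ) : Set (ProbabilityMeasure (E d × E d)) :=
  {ν₀ | ν₀ ∈ P₂₁ d ∧ ∀ η : ProbabilityMeasure (Curve d T),
    IsDissipative η → HasInitialDatum η ν₀ → dissipation η = 0}

/-- The lines `t ↦ x + t v`, `(x, v) ∈ S`, have empty mutual intersection during `[0, T)`: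
no two of them are at the same place at the same time. -/
def NonCrossing {d : ℕ} (T : ℝ) (S : Set (E d × E d)) : Prop :=
  S.Pairwise fun p q => ∀ t ∈ Ico 0 T, p.1 + t • p.2 ≠ q.1 + t • q.2

/-- The dissipative solution `η` is a free flow, concentrated on the straight lines
`t ↦ x + t v`, `(x, v) ∈ S`, which have empty mutual intersection. -/
def IsFreeFlowAlong {d : ℕ} {T : ℝ} (η : ProbabilityMeasure (Curve d T)) (S : Set (E d × E d)) :
    Prop :=
  IsDissipative η ∧ NonCrossing T S ∧
    ∀ᵐ (γ : Curve d T) ∂(η : Measure (Curve d T)), ∃ p ∈ S,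
      ∀ᵐ t ∂(timeMeasure T), (γ : L2Curve d T) t = p.1 + t • p.2

end

end PressurelessEuler

/-! Two particles that meet can be made to stick. Take an exchange-symmetric coupling of `ν₀` with
itself, concentrated on pairs whose free trajectories meet before `T`, and let the first particle of
a random pair move at the mean of the two velocities from the meeting on. After the meeting the pair
and its exchange have the same tail, so the velocity at time `t` is the conditional expectation of
the initial velocity given the tail, that is, `V`. The law of the first particle is therefore a
dissipative solution (`IsMeetingCoupling.isDissipative`).

By Pythagoras, `D(η)` is the time integral of `‖W₀ - V_t‖²`. Zero dissipation thus gives `W₀ = V_t`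
almost everywhere, and the curves are straight lines (`ae_eq_line_of_dissipation_eq_zero`). For `ν₀
∈ D₀` this applies to every sticky solution. A sticky path of a pair with different velocities has a
kink, so every such coupling charges only pairs of equal velocity
(`IsMeetingCoupling.ae_eq_velocity`).

Any measure on the crossing pairs with both marginals below `ν₀` can be symmetrized and completed on
the diagonal to such a coupling, hence vanishes. The crossing relation is `σ`-compact, and
Kellerer-type duality (`exists_null_cover_of_isCompact`) yields one `ν₀`-null set containing a
member of each crossing pair. Its complement is non-crossing; at time `0` this makes it a graph.
Uniqueness follows from rigidity again: all dissipative solutions consist of lines, which the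
initial datum determines. -/

namespace PressurelessEuler

noncomputable section

/-! ### Duality for relations that carry no coupling -/

section Kellerer

open Filter Topology BoundedContinuousFunction
open scoped NNReal CompactlySupported

/-- A finite measure is dominated by another one if this holds when tested against nonnegative
bounded continuous functions. -/
lemma measure_le_of_lintegral_bcnn_le {X : Type*} [MetricSpace X] [MeasurableSpace X]
    [BorelSpace X] {μ ν : Measure X} [IsFiniteMeasure μ] [IsFiniteMeasure ν]
    (h : ∀ f : X →ᵇ ℝ≥0, ∫⁻ x, f x ∂μ ≤ ∫⁻ x, f x ∂ν) : μ ≤ ν := by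
  have hclosed : ∀ F : Set X, IsClosed F → μ F ≤ ν F := by
    intro F hF
    refine ge_of_tendsto' (HasOuterApproxClosed.tendsto_lintegral_apprSeq hF ν) fun n => ?_
    exact (HasOuterApproxClosed.measure_le_lintegral hF μ n).trans (h _)
  refine Measure.le_iff.2 fun s hs => ?_
  -- Inner regularity by closed sets carries the inequality to all measurable sets.
  rw [hs.measure_eq_iSup_isClosed_of_ne_top (measure_ne_top μ s)]
  exact iSup₂_le fun F hFs => iSup_le fun hF => (hclosed F hF).trans (measure_mono hFs)

variable {X : Type*} [MetricSpace X] [MeasurableSpace X]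

/-- The costs of the pairs of functions `f, g ≥ 0` with `f ⊕ g ≥ φ` on `K`. -/
def dualCosts (ν : Measure X) (K : Set (X × X)) (φ : K → ℝ) : Set ℝ :=
  {c | ∃ f g : X →ᵇ ℝ≥0, (∀ z : K, φ z ≤ f z.1.1 + g z.1.2) ∧
    c = (∫⁻ x, f x ∂ν).toReal + (∫⁻ x, g x ∂ν).toReal}

lemma bddBelow_dualCosts (ν : Measure X) (K : Set (X × X)) (φ : K → ℝ) :
    BddBelow (dualCosts ν K φ) := by
  refine ⟨0, ?_⟩
  rintro c ⟨f, g, -, rfl⟩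
  positivity

lemma dualCosts_nonempty (ν : Measure X) {K : Set (X × X)} {φ : K → ℝ} {C : ℝ}
    (hC : ∀ z, φ z ≤ C) : (dualCosts ν K φ).Nonempty := by
  refine ⟨_, BoundedContinuousFunction.const X C.toNNReal, 0, fun z => ?_, rfl⟩
  simpa using Or.inl (hC z)

lemma add_mem_dualCosts [BorelSpace X] {ν : Measure X} [IsFiniteMeasure ν] {K : Set (X × X)} {φ ψ : K → ℝ}
    {a b : ℝ} (ha : a ∈ dualCosts ν K φ) (hb : b ∈ dualCosts ν K ψ) :
    a + b ∈ dualCosts ν K (φ + ψ) := by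
  obtain ⟨f, g, h, rfl⟩ := ha
  obtain ⟨f', g', h', rfl⟩ := hb
  refine ⟨f + f', g + g', fun z => ?_, ?_⟩
  · have := h z
    have := h' z
    simp only [Pi.add_apply, BoundedContinuousFunction.coe_add, NNReal.coe_add]
    linarith
  · have e : ∀ u v : X →ᵇ ℝ≥0, (∫⁻ x, (u + v) x ∂ν).toReal =
        (∫⁻ x, u x ∂ν).toReal + (∫⁻ x, v x ∂ν).toReal := by
      intro u v
      rw [← ENNReal.toReal_add (u.lintegral_lt_top_of_nnreal ν).ne
        (v.lintegral_lt_top_of_nnreal ν).ne, ← lintegral_add_left (by fun_prop)]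
      simp
    rw [e, e]
    ring

lemma smul_mem_dualCosts [BorelSpace X] {ν : Measure X} [IsFiniteMeasure ν] {K : Set (X × X)} {φ : K → ℝ}
    {a c : ℝ} (hc : 0 ≤ c) (ha : a ∈ dualCosts ν K φ) : c * a ∈ dualCosts ν K (c • φ) := by
  obtain ⟨f, g, h, rfl⟩ := ha
  lift c to ℝ≥0 using hc
  refine ⟨c • f, c • g, fun z => ?_, ?_⟩
  · have := mul_le_mul_of_nonneg_left (h z) c.coe_nonneg
    simpa [mul_add] using this
  · have e : ∀ u : X →ᵇ ℝ≥0, (∫⁻ x, (c • u) x ∂ν).toReal = c * (∫⁻ x, u x ∂ν).toReal := by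
      intro u
      have : ∫⁻ x, (c • u) x ∂ν = c * ∫⁻ x, u x ∂ν := by
        rw [← lintegral_const_mul _ (by fun_prop)]
        simp
      rw [this, ENNReal.toReal_mul, ENNReal.coe_toReal]
    rw [e, e]
    ring

/-- If a compact relation `K` supports no nonzero measure with both marginals dominated by `ν`,
then `K` is covered by `N × X ∪ X × N` with a null set `N`. -/
theorem exists_null_cover_of_isCompact [BorelSpace X] [SecondCountableTopology X] {ν : Measure X}
    [IsFiniteMeasure ν] {K : Set (X × X)} (hK : IsCompact K)
    (h : ∀ π : Measure (X × X), IsFiniteMeasure π → π Kᶜ = 0 → π.map Prod.fst ≤ ν →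
      π.map Prod.snd ≤ ν → π = 0) :
    ∃ N : Set X, MeasurableSet N ∧ ν N = 0 ∧ ∀ z ∈ K, z.1 ∈ N ∨ z.2 ∈ N := by
  have : CompactSpace K := isCompact_iff_compactSpace.1 hK
  -- The value of the dual problem is a sublinear functional. Either `N 1 = 0`, and near-optimal
  -- pairs `f, g` give the cover, or `N 1 > 0`, and Hahn–Banach produces a forbidden measure.
  let N : C(K, ℝ) → ℝ := fun φ => sInf (dualCosts ν K φ)
  have hne : ∀ φ : C(K, ℝ), (dualCosts ν K φ).Nonempty := fun φ =>
    dualCosts_nonempty ν (C := ‖φ‖) fun z => (le_abs_self _).trans (φ.norm_coe_le_norm z)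
  have hN_le : ∀ (φ : C(K, ℝ)) (c : ℝ), c ∈ dualCosts ν K φ → N φ ≤ c := fun φ c hc =>
    csInf_le (bddBelow_dualCosts ν K φ) hc
  have hN_nonneg : ∀ φ : C(K, ℝ), 0 ≤ N φ := fun φ =>
    le_csInf (hne φ) (by rintro c ⟨f, g, -, rfl⟩; positivity)
  have hN_nonpos : ∀ φ : C(K, ℝ), (∀ z, φ z ≤ 0) → N φ ≤ 0 := fun φ hφ =>
    hN_le φ 0 ⟨0, 0, fun z => by simpa using hφ z, by simp⟩
  have hom_le : ∀ c : ℝ, 0 < c → ∀ φ, N (c • φ) ≤ c * N φ := by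
    intro c hc φ
    rw [← div_le_iff₀' hc]
    refine le_csInf (hne φ) fun a ha => ?_
    rw [div_le_iff₀' hc]
    exact hN_le _ _ (smul_mem_dualCosts hc.le ha)
  have hom : ∀ c : ℝ, 0 < c → ∀ φ, N (c • φ) = c * N φ := by
    intro c hc φ
    refine le_antisymm (hom_le c hc φ) ?_
    have := hom_le c⁻¹ (inv_pos.2 hc) (c • φ)
    rw [smul_smul, inv_mul_cancel₀ hc.ne', one_smul] at this
    rwa [← le_inv_mul_iff₀ hc]
  have add : ∀ φ ψ, N (φ + ψ) ≤ N φ + N ψ := by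
    intro φ ψ
    refine le_of_forall_pos_lt_add fun ε hε => ?_
    obtain ⟨a, ha, ha'⟩ := exists_lt_of_csInf_lt (hne φ) (lt_add_of_pos_right (N φ) (half_pos hε))
    obtain ⟨b, hb, hb'⟩ := exists_lt_of_csInf_lt (hne ψ) (lt_add_of_pos_right (N ψ) (half_pos hε))
    have := hN_le (φ + ψ) (a + b) (add_mem_dualCosts ha hb)
    linarith
  by_cases hone : N 1 = 0
  -- Where `f ⊕ g ≥ 1`, one of the two values is at least `1/2`. Markov's inequality turns a cost
  -- below `2⁻ⁿ` into superlevel sets of measure at most `2 · 2⁻ⁿ`, which is summable for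
  -- Borel–Cantelli.
  · have hcov : ∀ n : ℕ, ∃ B : Set X, MeasurableSet B ∧ ν B ≤ 2 * (2⁻¹ : ℝ≥0∞) ^ n * 2 ∧
        ∀ z ∈ K, z.1 ∈ B ∨ z.2 ∈ B := by
      intro n
      have hpos : N 1 < (2⁻¹ : ℝ) ^ n := by rw [hone]; positivity
      obtain ⟨a, ⟨f, g, hfg, rfl⟩, ha'⟩ := exists_lt_of_csInf_lt (hne 1) hpos
      refine ⟨{x | (2⁻¹ : ℝ≥0∞) ≤ f x} ∪ {x | (2⁻¹ : ℝ≥0∞) ≤ g x}, ?_, ?_, ?_⟩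
      · exact (measurableSet_le measurable_const (by fun_prop)).union
          (measurableSet_le measurable_const (by fun_prop))
      · have key : ∀ u : X →ᵇ ℝ≥0, (∫⁻ x, u x ∂ν).toReal < (2⁻¹ : ℝ) ^ n →
            ν {x | (2⁻¹ : ℝ≥0∞) ≤ u x} ≤ 2 * (2⁻¹ : ℝ≥0∞) ^ n := by
          intro u hu
          have h1 := mul_meas_ge_le_lintegral (μ := ν) (f := fun x => (u x : ℝ≥0∞))
            (by fun_prop) 2⁻¹
          have h2 : ∫⁻ x, u x ∂ν ≤ (2⁻¹ : ℝ≥0∞) ^ n := by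
            rw [← ENNReal.toReal_le_toReal (u.lintegral_lt_top_of_nnreal ν).ne (by simp)]
            simpa using hu.le
          calc ν {x | (2⁻¹ : ℝ≥0∞) ≤ u x} = 2 * (2⁻¹ * ν {x | (2⁻¹ : ℝ≥0∞) ≤ u x}) := by
                rw [← mul_assoc, ENNReal.mul_inv_cancel (by norm_num) (by norm_num), one_mul]
            _ ≤ 2 * (2⁻¹ : ℝ≥0∞) ^ n := by gcongr; exact h1.trans h2
        refine (measure_union_le _ _).trans ?_
        rw [mul_two]
        refine add_le_add (key f ?_) (key g ?_)
        · exact lt_of_le_of_lt (le_add_of_nonneg_right ENNReal.toReal_nonneg) ha'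
        · exact lt_of_le_of_lt (le_add_of_nonneg_left ENNReal.toReal_nonneg) ha'
      · intro z hz
        have h1 := hfg ⟨z, hz⟩
        by_contra hcon
        have hcon : (f z.1 : ℝ≥0∞) < 2⁻¹ ∧ (g z.2 : ℝ≥0∞) < 2⁻¹ := by
          rw [not_or] at hcon
          exact ⟨not_le.1 fun h' => hcon.1 (Or.inl h'), not_le.1 fun h' => hcon.2 (Or.inr h')⟩
        have e : (2⁻¹ : ℝ≥0∞) = ((2⁻¹ : ℝ≥0) : ℝ≥0∞) := by simp
        rw [e, ENNReal.coe_lt_coe, ENNReal.coe_lt_coe] at hcon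
        have h2 := NNReal.coe_lt_coe.2 hcon.1
        have h3 := NNReal.coe_lt_coe.2 hcon.2
        simp only [ContinuousMap.one_apply, NNReal.coe_inv, NNReal.coe_ofNat] at h1 h2 h3
        linarith
    choose B hB hνB hKB using hcov
    refine ⟨limsup B atTop, .measurableSet_limsup hB, ?_, fun z hz => ?_⟩
    · refine measure_limsup_atTop_eq_zero (ne_top_of_le_ne_top ?_ (ENNReal.tsum_le_tsum hνB))
      rw [ENNReal.tsum_mul_right, ENNReal.tsum_mul_left, ENNReal.tsum_geometric]
      norm_num
    -- For every `n` one of the two coordinates lies in `B n`, so one of them does so for infinitely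
    -- many `n`.
    · simp only [mem_limsup_iff_frequently_mem]
      rw [← frequently_or_distrib]
      exact (Eventually.of_forall fun n => hKB n z hz).frequently
  · exfalso
    have hpos : 0 < N 1 := lt_of_le_of_ne (hN_nonneg 1) (Ne.symm hone)
    have one_ne : (1 : C(K, ℝ)) ≠ 0 := by
      intro h0
      refine hone (le_antisymm (hN_nonpos 1 fun z => ?_) (hN_nonneg 1))
      rw [h0]; simp
    -- Extend `a • 1 ↦ a * N 1` to a linear functional below `N`. It is positive because `N ≤ 0` on
    -- nonpositive functions, hence it is integration against a measure `m` by Riesz.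
    obtain ⟨Λ, hΛ1, hΛ⟩ := exists_extension_of_le_sublinear
      (LinearPMap.mkSpanSingleton (1 : C(K, ℝ)) (N 1) one_ne) N hom add (by
        rintro ⟨x, hx⟩
        obtain ⟨a, rfl⟩ := Submodule.mem_span_singleton.1 hx
        rw [show LinearPMap.mkSpanSingleton (1 : C(K, ℝ)) (N 1) one_ne ⟨a • 1, hx⟩ = a • N 1 from
          LinearPMap.mkSpanSingleton'_apply _ _ _ a hx]
        rcases lt_or_ge 0 a with ha | ha
        · simp [hom a ha]
        · exact (mul_nonpos_of_nonpos_of_nonneg ha hpos.le).trans (hN_nonneg _))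
    have hΛone : Λ 1 = N 1 := by
      have := hΛ1 ⟨(1 : C(K, ℝ)), Submodule.mem_span_singleton_self _⟩
      rw [this]
      exact LinearPMap.mkSpanSingleton_apply ℝ ℝ one_ne (N 1)
    have hΛpos : ∀ φ : C(K, ℝ), (∀ z, 0 ≤ φ z) → 0 ≤ Λ φ := by
      intro φ hφ
      have := (hΛ (-φ)).trans (hN_nonpos (-φ) fun z => by simpa using hφ z)
      rw [map_neg] at this
      linarith
    let Λ' : C_c(K, ℝ) →ₚ[ℝ] ℝ := PositiveLinearMap.mk₀
      { toFun := fun φ => Λ φ.toContinuousMap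
        map_add' := fun φ ψ => by rw [← map_add]; rfl
        map_smul' := fun c φ => by rw [RingHom.id_apply, ← map_smul]; rfl }
      (fun φ hφ => hΛpos _ hφ)
    let m : Measure K := RealRMK.rieszMeasure Λ'
    have hm : ∀ φ : C(K, ℝ), ∫ z, φ z ∂m = Λ φ := fun φ =>
      RealRMK.integral_rieszMeasure Λ' ⟨φ, HasCompactSupport.of_compactSpace φ⟩
    have hKm : MeasurableSet K := hK.isClosed.measurableSet
    -- The pairs `(f, 0)` and `(0, f)` are admissible for `f` composed with a projection, so `Λ ≤ N`
    -- bounds the marginals of `m` by `ν`.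
    have hmap : ∀ (p : X × X → X), Continuous p →
        (∀ f : X →ᵇ ℝ≥0, (∫⁻ x, f x ∂ν).toReal ∈ dualCosts ν K (fun z => f (p z))) →
        (m.map Subtype.val).map p ≤ ν := by
      intro p hp hcost
      refine measure_le_of_lintegral_bcnn_le fun f => ?_
      rw [lintegral_map (by fun_prop) hp.measurable,
        lintegral_map (by fun_prop) measurable_subtype_coe]
      let φ : C(K, ℝ) := ⟨fun z => f (p z), by fun_prop⟩
      have h1 := hm φ
      have h2 : Λ φ ≤ (∫⁻ x, f x ∂ν).toReal := (hΛ φ).trans (hN_le φ _ (hcost f))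
      rw [← h1, integral_eq_lintegral_of_nonneg_ae (Eventually.of_forall fun z => by simp [φ])
        (by fun_prop)] at h2
      have h3 : ∫⁻ z, ENNReal.ofReal (φ z) ∂m = ∫⁻ z : K, f (p z) ∂m := by
        refine lintegral_congr fun z => ?_
        simp [φ]
      rw [h3] at h2
      refine (ENNReal.toReal_le_toReal ?_ (f.lintegral_lt_top_of_nnreal ν).ne).1 h2
      have := (f.compContinuous ⟨fun z : K => p z, by fun_prop⟩).lintegral_lt_top_of_nnreal m
      exact this.ne
    have hzero := h (m.map Subtype.val) inferInstance
      (by rw [Measure.map_apply measurable_subtype_coe hKm.compl]; simp)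
      (hmap _ continuous_fst fun f => ⟨f, 0, by simp, by simp⟩)
      (hmap _ continuous_snd fun f => ⟨0, f, by simp, by simp⟩)
    have hm0 : m = 0 := by
      rwa [Measure.map_eq_zero_iff measurable_subtype_coe.aemeasurable] at hzero
    have := hm 1
    rw [hm0, hΛone] at this
    simp at this
    exact hone this.symm

/-- The previous theorem for `σ`-compact relations. -/
theorem exists_null_cover_of_iUnion_isCompact [BorelSpace X] [SecondCountableTopology X] {ν : Measure X}
    [IsFiniteMeasure ν] {K : ℕ → Set (X × X)} (hK : ∀ n, IsCompact (K n))
    (h : ∀ π : Measure (X × X), IsFiniteMeasure π → π (⋃ n, K n)ᶜ = 0 → π.map Prod.fst ≤ ν →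
      π.map Prod.snd ≤ ν → π = 0) :
    ∃ N : Set X, MeasurableSet N ∧ ν N = 0 ∧ ∀ z ∈ ⋃ n, K n, z.1 ∈ N ∨ z.2 ∈ N := by
  have : ∀ n, ∃ N : Set X, MeasurableSet N ∧ ν N = 0 ∧ ∀ z ∈ K n, z.1 ∈ N ∨ z.2 ∈ N := fun n =>
    exists_null_cover_of_isCompact (hK n) fun π hπ h0 =>
      h π hπ (measure_mono_null (compl_subset_compl.2 (subset_iUnion K n)) h0)
  choose N hN hνN hKN using this
  refine ⟨⋃ n, N n, .iUnion hN, measure_iUnion_null hνN, fun z hz => ?_⟩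
  obtain ⟨n, hn⟩ := mem_iUnion.1 hz
  exact (hKN n z hn).imp (fun h => mem_iUnion.2 ⟨n, h⟩) fun h => mem_iUnion.2 ⟨n, h⟩

end Kellerer

/-! ### Measurable functionals of curves: velocity, tail and initial state -/

section CurveFunctionals

open Filter Topology

variable {d : ℕ} {T : ℝ}

instance instIsFiniteMeasureTime : IsFiniteMeasure (timeMeasure T) :=
  ⟨by rw [Measure.restrict_apply_univ]; exact measure_Ioo_lt_top⟩

/-- The integral over a set is a continuous functional on `L²` of a finite measure. -/
lemma continuous_setIntegral_Lp_two (μ : Measure ℝ) [IsFiniteMeasure μ] {S : Set ℝ}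
    (hS : MeasurableSet S) : Continuous fun f : Lp (E d) 2 μ => ∫ s in S, f s ∂μ := by
  let b := EuclideanSpace.basisFun (Fin d) ℝ
  have h : ∀ f : Lp (E d) 2 μ, ∫ s in S, f s ∂μ =
      ∑ i, inner ℝ (indicatorConstLp 2 hS (measure_ne_top μ S) (b i)) f • b i := by
    intro f
    conv_lhs => rw [← b.sum_repr' (∫ s in S, f s ∂μ)]
    refine Finset.sum_congr rfl fun i _ => ?_
    rw [L2.inner_indicatorConstLp_eq_inner_setIntegral]
  simp_rw [h]
  fun_prop

lemma integrable_Lp_two {μ : Measure ℝ} [IsFiniteMeasure μ] (f : Lp (E d) 2 μ) :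
    Integrable f μ :=
  (Lp.memLp f).integrable one_le_two

/-- Maps into `L²` given by a jointly measurable function are measurable. -/
lemma measurable_toLp {P : Type*} [MeasurableSpace P] {μ : Measure ℝ} [SigmaFinite μ]
    [MeasurableSpace (Lp (E d) 2 μ)] [BorelSpace (Lp (E d) 2 μ)] {f : P → ℝ → E d}
    (hf : Measurable (Function.uncurry f)) (hm : ∀ p, MemLp (f p) 2 μ) :
    Measurable fun p => (hm p).toLp (f p) := by
  -- Distances to a dense sequence embed `L²` continuously and injectively into `ℕ → ℝ`. By
  -- Lusin–Souslin this is a measurable embedding, so it suffices that each distance is measurable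
  -- in the parameter, which is Tonelli.
  let D : ℕ → Lp (E d) 2 μ := TopologicalSpace.denseSeq _
  let Φ : Lp (E d) 2 μ → ℕ → ℝ := fun g n => dist g (D n)
  have hΦ : Continuous Φ := by fun_prop
  have hinj : Function.Injective Φ := by
    intro g g' h
    have hg : Tendsto (fun x => dist g x - dist g' x) (𝓝 g) (𝓝 (dist g g - dist g' g)) :=
      Continuous.tendsto (by fun_prop) g
    have heq : (fun x => dist g x - dist g' x) = 0 := by
      refine Continuous.ext_on (TopologicalSpace.denseRange_denseSeq (Lp (E d) 2 μ)) (by fun_prop)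
        continuous_zero ?_
      rintro _ ⟨n, rfl⟩
      exact sub_eq_zero.2 (congrFun h n)
    have := congrFun heq g
    simp only [dist_self, Pi.zero_apply, zero_sub, neg_eq_zero] at this
    exact (dist_eq_zero.1 this).symm
  rw [← (hΦ.measurableEmbedding hinj).measurable_comp_iff]
  refine measurable_pi_lambda _ fun n => ?_
  have h : ∀ p, dist ((hm p).toLp (f p)) (D n) =
      (∫⁻ t, ‖f p t - D n t‖ₑ ^ 2 ∂μ).toReal ^ (1 / 2 : ℝ) := by
    intro p
    rw [Lp.dist_def, eLpNorm_eq_lintegral_rpow_enorm_toReal (by norm_num) (by norm_num),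
      ENNReal.toReal_rpow]
    congr 2
    refine lintegral_congr_ae ?_
    filter_upwards [(hm p).coeFn_toLp] with t ht
    simp [ht]
  simp only [Φ, Function.comp_def, h]
  have hD : Measurable (D n) := (Lp.stronglyMeasurable (D n)).measurable
  refine (Measurable.pow_const (Measurable.ennreal_toReal ?_) _)
  refine Measurable.lintegral_prod_right' (f := fun q : P × ℝ => ‖f q.1 q.2 - D n q.2‖ₑ ^ 2) ?_
  exact ((hf.sub (hD.comp measurable_snd)).enorm).pow_const 2

lemma integral_Ioc_of_affine {f : ℝ → E d} {a b : E d} {α β : ℝ} (h : α ≤ β) (hα : -1 ≤ α)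
    (hβ : β < T) (hf : ∀ᵐ s ∂timeMeasure T, s ∈ Ioo α β → f s = a + s • b) :
    ∫ s in Ioc α β, f s ∂timeMeasure T = (β - α) • a + ((β ^ 2 - α ^ 2) / 2) • b := by
  have e : (timeMeasure T).restrict (Ioc α β) = volume.restrict (Ioo α β) := by
    rw [← Measure.restrict_congr_set Ioo_ae_eq_Ioc,
      Measure.restrict_restrict measurableSet_Ioo, inter_eq_left.2 (Ioo_subset_Ioo hα hβ.le)]
  have hf' : ∀ᵐ s ∂volume.restrict (Ioo α β), f s = a + s • b := by
    have := ae_restrict_of_ae (s := Ioo α β) hf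
    rw [Measure.restrict_restrict measurableSet_Ioo,
      inter_eq_left.2 (Ioo_subset_Ioo hα hβ.le)] at this
    filter_upwards [this, ae_restrict_mem measurableSet_Ioo] with s hs hs' using hs hs'
  rw [e, integral_congr_ae hf', ← integral_Ioc_eq_integral_Ioo,
    ← intervalIntegral.integral_of_le h, intervalIntegral.integral_add
      (Continuous.intervalIntegrable (by fun_prop) _ _) (Continuous.intervalIntegrable (by fun_prop) _ _),
    intervalIntegral.integral_smul_const, integral_id]
  simp

/-- The second difference quotient of the primitive of `f` at `t`, with step `1 / (n + 1)`. -/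
def slopeApprox {μ : Measure ℝ} (n : ℕ) (t : ℝ) (f : Lp (E d) 2 μ) : E d :=
  ((n : ℝ) + 1) ^ 2 • ((∫ s in Ioc (t + 1 / ((n : ℝ) + 1)) (t + 2 / ((n : ℝ) + 1)), f s ∂μ) -
    ∫ s in Ioc t (t + 1 / ((n : ℝ) + 1)), f s ∂μ)

lemma continuous_slopeApprox (μ : Measure ℝ) [IsFiniteMeasure μ] (n : ℕ) (t : ℝ) :
    Continuous fun f : Lp (E d) 2 μ => slopeApprox n t f :=
  Continuous.const_smul (Continuous.sub (continuous_setIntegral_Lp_two μ measurableSet_Ioc)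
    (continuous_setIntegral_Lp_two μ measurableSet_Ioc)) (((n : ℝ) + 1) ^ 2)

lemma continuous_slopeApprox_time (n : ℕ) (f : L2Curve d T) :
    Continuous fun t : ℝ => slopeApprox n t f := by
  have h1 : (0 : ℝ) ≤ 1 / ((n : ℝ) + 1) := by positivity
  have h2 : 1 / ((n : ℝ) + 1) ≤ 2 / ((n : ℝ) + 1) := by gcongr; norm_num
  have hint : ∀ a b : ℝ, IntervalIntegrable f (timeMeasure T) a b := fun a b =>
    (integrable_Lp_two f).intervalIntegrable
  have hP := intervalIntegral.continuous_primitive hint 0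
  have key : ∀ t : ℝ, slopeApprox n t f = ((n : ℝ) + 1) ^ 2 •
      (((∫ s in 0..(t + 2 / ((n : ℝ) + 1)), f s ∂timeMeasure T) -
        ∫ s in 0..(t + 1 / ((n : ℝ) + 1)), f s ∂timeMeasure T) -
      ((∫ s in 0..(t + 1 / ((n : ℝ) + 1)), f s ∂timeMeasure T) -
        ∫ s in 0..t, f s ∂timeMeasure T)) := by
    intro t
    rw [slopeApprox, intervalIntegral.integral_interval_sub_left (hint _ _) (hint _ _),
      intervalIntegral.integral_interval_sub_left (hint _ _) (hint _ _),
      intervalIntegral.integral_of_le (by linarith), intervalIntegral.integral_of_le (by linarith)]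
  simp_rw [key]
  exact Continuous.const_smul (Continuous.sub
    ((hP.comp (by fun_prop : Continuous fun t : ℝ => t + 2 / ((n : ℝ) + 1))).sub
      (hP.comp (by fun_prop : Continuous fun t : ℝ => t + 1 / ((n : ℝ) + 1))))
    ((hP.comp (by fun_prop : Continuous fun t : ℝ => t + 1 / ((n : ℝ) + 1))).sub hP))
    (((n : ℝ) + 1) ^ 2)

lemma slopeApprox_of_affine {f : L2Curve d T} {a b : E d} {n : ℕ} {t : ℝ} (ht : -1 ≤ t)
    (hT : t + 2 / ((n : ℝ) + 1) < T)
    (hf : ∀ᵐ s ∂timeMeasure T, s ∈ Ioo t (t + 2 / ((n : ℝ) + 1)) → f s = a + s • b) :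
    slopeApprox n t f = b := by
  have h1 : (0 : ℝ) ≤ 1 / ((n : ℝ) + 1) := by positivity
  have h2 : 1 / ((n : ℝ) + 1) ≤ 2 / ((n : ℝ) + 1) := by gcongr; norm_num
  rw [slopeApprox, integral_Ioc_of_affine (a := a) (b := b) (by linarith) (by linarith) hT
    (hf.mono fun s hs hs' => hs ⟨by linarith [hs'.1], hs'.2⟩),
    integral_Ioc_of_affine (a := a) (b := b) (by linarith) ht (by linarith)
    (hf.mono fun s hs hs' => hs ⟨hs'.1, by linarith [hs'.2]⟩)]
  have hn : (n : ℝ) + 1 ≠ 0 := by positivity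
  match_scalars <;> field_simp <;> ring

/-- The right derivative of a curve, defined wherever the difference quotients converge. -/
def velocity (t : ℝ) (γ : Curve d T) : E d :=
  limUnder atTop fun n : ℕ => slopeApprox n t (γ : L2Curve d T)

/-- Each approximation is continuous in `t` and measurable in `γ`, hence jointly measurable
(Carathéodory), and `limUnder` preserves this. -/
lemma measurable_velocity : Measurable (Function.uncurry (velocity (d := d) (T := T))) := by
  refine StronglyMeasurable.measurable (StronglyMeasurable.limUnder fun n => ?_)
  refine Measurable.stronglyMeasurable ?_
  exact measurable_uncurry_of_continuous_of_measurable
    (u := fun t (γ : Curve d T) => slopeApprox n t (γ : L2Curve d T))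
    (fun γ => continuous_slopeApprox_time n _)
    (fun t => ((continuous_slopeApprox _ n t).comp continuous_subtype_val).measurable)

lemma continuous_tail (t : ℝ) : Continuous (tail (d := d) (T := T) t) :=
  (LpToLpRestrictCLM ℝ (E d) ℝ (timeMeasure T) 2 (Ioo t T)).continuous.comp continuous_subtype_val

lemma measurable_tail (t : ℝ) : Measurable (tail (d := d) (T := T) t) :=
  (continuous_tail t).measurable

lemma tail_ae_eq (t : ℝ) (γ : Curve d T) :
    tail t γ =ᵐ[(timeMeasure T).restrict (Ioo t T)] (γ : L2Curve d T) :=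
  LpToLpRestrictCLM_coeFn (p := 2) (μ := timeMeasure T) ℝ (Ioo t T) (γ : L2Curve d T)

/-- The difference quotient looks only forward, at times after `t`; this makes the velocity a
function of the tail. -/
lemma slopeApprox_tail (n : ℕ) (t : ℝ) (γ : Curve d T) :
    slopeApprox n t (tail t γ) = slopeApprox n t (γ : L2Curve d T) := by
  have key : ∀ α β : ℝ, t ≤ α → ∫ s in Ioc α β, tail t γ s ∂(timeMeasure T).restrict (Ioo t T) =
      ∫ s in Ioc α β, (γ : L2Curve d T) s ∂timeMeasure T := by
    intro α β hα
    rw [integral_congr_ae (ae_restrict_of_ae (tail_ae_eq t γ))]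
    congr 1
    rw [Measure.restrict_restrict measurableSet_Ioc, Measure.restrict_restrict
      (measurableSet_Ioc.inter measurableSet_Ioo), Measure.restrict_restrict measurableSet_Ioc]
    congr 1
    ext s
    simp only [mem_inter_iff, mem_Ioc, mem_Ioo]
    constructor
    · rintro ⟨⟨h1, -⟩, h2⟩
      exact ⟨h1, h2⟩
    · rintro ⟨h1, h2⟩
      exact ⟨⟨h1, by linarith [h1.1], h2.2⟩, h2⟩
  have h1 : (0 : ℝ) ≤ 1 / ((n : ℝ) + 1) := by positivity
  rw [slopeApprox, slopeApprox, key _ _ (by linarith), key _ _ le_rfl]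

/-- The velocity at time `t` only depends on the curve after time `t`. -/
lemma stronglyMeasurable_velocity_comap_tail (t : ℝ) :
    StronglyMeasurable[MeasurableSpace.comap (tail (d := d) (T := T) t) inferInstance]
      (velocity (d := d) (T := T) t) := by
  have h : velocity (d := d) (T := T) t = (fun g : TailCurve d T t =>
      limUnder atTop fun n : ℕ => slopeApprox n t g) ∘ tail t := by
    funext γ
    simp only [velocity, Function.comp_apply, slopeApprox_tail]
  rw [h]
  refine StronglyMeasurable.comp_measurable (StronglyMeasurable.limUnder fun n => ?_)
    (comap_measurable _)
  exact (continuous_slopeApprox _ n t).measurable.stronglyMeasurable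

lemma velocity_of_affine {γ : Curve d T} {a b : E d} {t β : ℝ} (ht : -1 ≤ t) (htβ : t < β)
    (hβ : β ≤ T) (hγ : ∀ᵐ s ∂timeMeasure T, s ∈ Ioo t β → (γ : L2Curve d T) s = a + s • b) :
    velocity t γ = b := by
  refine Tendsto.limUnder_eq (tendsto_const_nhds.congr' ?_)
  have h : Tendsto (fun n : ℕ => t + 2 / ((n : ℝ) + 1)) atTop (𝓝 (t + 0)) :=
    tendsto_const_nhds.add (tendsto_const_nhds.div_atTop
      (tendsto_atTop_add_const_right _ _ tendsto_natCast_atTop_atTop))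
  rw [add_zero] at h
  filter_upwards [h.eventually (gt_mem_nhds htβ)] with n hn
  refine (slopeApprox_of_affine (a := a) ht (by linarith) ?_).symm
  exact hγ.mono fun s hs hs' => hs ⟨hs'.1, by linarith [hs'.2]⟩

/-- The integrals of a curve over the two halves of `(-1, 0)` determine the affine part. -/
lemma affine_eq_integrals (hT : 0 < T) {γ : Curve d T} {a b : E d}
    (hγ : ∀ᵐ s ∂(timeMeasure T).restrict (Ioo (-1) 0), (γ : L2Curve d T) s = a + s • b) :
    a = (3 : ℝ) • (∫ s in Ioc (-1 / 2 : ℝ) 0, (γ : L2Curve d T) s ∂timeMeasure T) -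
      ∫ s in Ioc (-1) (-1 / 2 : ℝ), (γ : L2Curve d T) s ∂timeMeasure T ∧
    b = (4 : ℝ) • ((∫ s in Ioc (-1 / 2 : ℝ) 0, (γ : L2Curve d T) s ∂timeMeasure T) -
      ∫ s in Ioc (-1) (-1 / 2 : ℝ), (γ : L2Curve d T) s ∂timeMeasure T) := by
  -- The integrals of `a + s • b` over the right and left halves are `a/2 - b/8` and `a/2 - 3b/8`;
  -- the coefficients `3` and `4` solve this system.
  rw [ae_restrict_iff' measurableSet_Ioo] at hγ
  rw [integral_Ioc_of_affine (a := a) (b := b) (by norm_num) (by norm_num) hT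
    (hγ.mono fun s hs hs' => hs ⟨by linarith [hs'.1], hs'.2⟩),
    integral_Ioc_of_affine (a := a) (b := b) (by norm_num) (by norm_num) (by linarith)
    (hγ.mono fun s hs hs' => hs ⟨hs'.1, by linarith [hs'.2]⟩)]
  constructor <;> module

lemma ae_eq_initialAffine (γ : Curve d T) :
    ∀ᵐ s ∂(timeMeasure T).restrict (Ioo (-1) 0), (γ : L2Curve d T) s = e₀ γ + s • W₀ γ := by
  filter_upwards [Classical.choose_spec γ.2] with s hs
  rw [hs]
  simp [e₀, W₀, initialAffine]

/-- The integral formulas remove the dependence on the choice made in `initialAffine`. -/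
lemma e₀_eq_of_affine (hT : 0 < T) {γ : Curve d T} {a b : E d}
    (hγ : ∀ᵐ s ∂(timeMeasure T).restrict (Ioo (-1) 0), (γ : L2Curve d T) s = a + s • b) :
    e₀ γ = a := by
  rw [(affine_eq_integrals hT hγ).1, (affine_eq_integrals hT (ae_eq_initialAffine γ)).1]

lemma W₀_eq_of_affine (hT : 0 < T) {γ : Curve d T} {a b : E d}
    (hγ : ∀ᵐ s ∂(timeMeasure T).restrict (Ioo (-1) 0), (γ : L2Curve d T) s = a + s • b) :
    W₀ γ = b := by
  rw [(affine_eq_integrals hT hγ).2, (affine_eq_integrals hT (ae_eq_initialAffine γ)).2]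

lemma measurable_e₀ (hT : 0 < T) : Measurable (e₀ (d := d) (T := T)) := by
  refine Continuous.measurable ?_
  simp_rw [funext fun γ : Curve d T => (affine_eq_integrals hT (ae_eq_initialAffine γ)).1]
  exact (((continuous_setIntegral_Lp_two _ measurableSet_Ioc).comp
    continuous_subtype_val).const_smul (3 : ℝ)).sub
    ((continuous_setIntegral_Lp_two _ measurableSet_Ioc).comp continuous_subtype_val)

lemma measurable_W₀ (hT : 0 < T) : Measurable (W₀ (d := d) (T := T)) := by
  refine Continuous.measurable ?_
  simp_rw [funext fun γ : Curve d T => (affine_eq_integrals hT (ae_eq_initialAffine γ)).2]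
  exact (((continuous_setIntegral_Lp_two _ measurableSet_Ioc).comp
    continuous_subtype_val).sub
    ((continuous_setIntegral_Lp_two _ measurableSet_Ioc).comp
      continuous_subtype_val)).const_smul (4 : ℝ)

end CurveFunctionals

/-! ### Two particles that stick when they meet -/

section StickyPairs

open Filter Topology

variable {d : ℕ} {T : ℝ}

/-- Pairs of initial states (position and velocity) of particles. -/
abbrev StatePair (d : ℕ) : Type := (E d × E d) × (E d × E d)

/-- The time at which two free particles meet, if they do and their velocities differ. -/
def meetingTime (z : StatePair d) : ℝ :=
  max 0 (-(inner ℝ (z.1.1 - z.2.1) (z.1.2 - z.2.2)) / ‖z.1.2 - z.2.2‖ ^ 2)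

/-- The trajectory of the first particle of a pair which stays with the second one, at the mean
of their velocities, from the meeting time on. -/
def path (z : StatePair d) (t : ℝ) : E d :=
  z.1.1 + t • z.1.2 + max (t - meetingTime z) 0 • ((1 / 2 : ℝ) • (z.2.2 - z.1.2))

/-- The right derivative of `path`. -/
def pathVelocity (z : StatePair d) (t : ℝ) : E d :=
  z.1.2 + (if meetingTime z ≤ t then (1 : ℝ) else 0) • ((1 / 2 : ℝ) • (z.2.2 - z.1.2))

/-- The pairs of particles which are at the same place at their meeting time, before `T`. -/
def meetingPairs (d : ℕ) (T : ℝ) : Set (StatePair d) :=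
  {z | meetingTime z < T ∧ z.1.1 + meetingTime z • z.1.2 = z.2.1 + meetingTime z • z.2.2}

lemma meetingTime_nonneg (z : StatePair d) : 0 ≤ meetingTime z := le_max_left _ _

lemma meetingTime_swap (z : StatePair d) : meetingTime z.swap = meetingTime z := by
  simp only [meetingTime, Prod.fst_swap, Prod.snd_swap]
  rw [← neg_sub z.1.1, ← neg_sub z.1.2, inner_neg_neg, norm_neg]

/-- Division by zero gives `0`, so equal velocities have meeting time `0`; identical particles then
count as a meeting pair. -/
lemma meetingTime_diag (p : E d × E d) : meetingTime (p, p) = 0 := by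
  simp [meetingTime]

/-- At a meeting the relative position is `-t` times the relative velocity, so the projection
quotient in `meetingTime` returns `t`. -/
lemma meetingTime_eq {z : StatePair d} {t : ℝ} (ht : 0 ≤ t)
    (h : z.1.1 + t • z.1.2 = z.2.1 + t • z.2.2) (hne : z.1.2 ≠ z.2.2) : meetingTime z = t := by
  have hx : z.1.1 - z.2.1 = -(t • (z.1.2 - z.2.2)) := by
    rw [smul_sub, sub_eq_iff_eq_add, eq_comm, ← sub_eq_iff_eq_add'.2 h.symm]
    abel
  have hn : ‖z.1.2 - z.2.2‖ ^ 2 ≠ 0 := by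
    simpa using sub_ne_zero.2 hne
  rw [meetingTime, hx, inner_neg_left, neg_neg, real_inner_smul_left, real_inner_self_eq_norm_sq,
    mul_div_cancel_right₀ _ hn, max_eq_right ht]

lemma measurable_meetingTime : Measurable (meetingTime (d := d)) := by
  unfold meetingTime
  fun_prop

lemma measurableSet_meetingPairs : MeasurableSet (meetingPairs d T) := by
  have := measurable_meetingTime (d := d)
  exact (measurableSet_lt this measurable_const).inter
    (measurableSet_eq_fun (by fun_prop) (by fun_prop))

lemma swap_mem_meetingPairs {z : StatePair d} (hz : z ∈ meetingPairs d T) :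
    z.swap ∈ meetingPairs d T := by
  refine ⟨by rw [meetingTime_swap]; exact hz.1, ?_⟩
  rw [meetingTime_swap]
  exact hz.2.symm

lemma diag_mem_meetingPairs (hT : 0 < T) (p : E d × E d) : (p, p) ∈ meetingPairs d T :=
  ⟨by rwa [meetingTime_diag], rfl⟩

/-- From the meeting on, both paths are the common meeting point plus elapsed time times the mean
velocity. -/
lemma path_swap {z : StatePair d} (hz : z ∈ meetingPairs d T) {t : ℝ} (ht : meetingTime z ≤ t) :
    path z.swap t = path z t := by
  simp only [path, meetingTime_swap, max_eq_left (sub_nonneg.2 ht), Prod.fst_swap, Prod.snd_swap]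
  have h := sub_eq_zero.2 hz.2
  rw [← sub_eq_zero, ← neg_eq_zero, ← h]
  module

lemma continuous_path (z : StatePair d) : Continuous (path z) := by
  unfold path
  fun_prop

lemma measurable_path : Measurable (Function.uncurry (path (d := d))) := by
  have := measurable_meetingTime (d := d)
  unfold path Function.uncurry
  fun_prop

lemma measurable_pathVelocity : Measurable (Function.uncurry (pathVelocity (d := d))) := by
  have h := measurable_meetingTime (d := d)
  unfold pathVelocity Function.uncurry
  have h1 : Measurable fun p : StatePair d × ℝ => if meetingTime p.1 ≤ p.2 then (1 : ℝ) else 0 :=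
    Measurable.ite (measurableSet_le (h.comp measurable_fst) measurable_snd) measurable_const
      measurable_const
  fun_prop

lemma hasDerivWithinAt_path (z : StatePair d) (t : ℝ) :
    HasDerivWithinAt (path z) (pathVelocity z t) (Ioi t) t := by
  have h1 : HasDerivWithinAt (fun s : ℝ => max (s - meetingTime z) 0)
      (if meetingTime z ≤ t then (1 : ℝ) else 0) (Ioi t) t := by
    split_ifs with h
    · refine (((hasDerivAt_id t).sub_const (meetingTime z)).hasDerivWithinAt).congr ?_ ?_
      · intro s hs
        exact max_eq_left (sub_nonneg.2 (h.trans (mem_Ioi.1 hs).le))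
      · exact max_eq_left (sub_nonneg.2 h)
    · refine ((hasDerivAt_const t (0 : ℝ)).congr_of_eventuallyEq ?_).hasDerivWithinAt
      filter_upwards [gt_mem_nhds (not_le.1 h)] with s hs
      exact max_eq_right (by linarith)
  have h2 : HasDerivAt (fun s : ℝ => z.1.1 + s • z.1.2) ((1 : ℝ) • z.1.2) t :=
    ((hasDerivAt_id t).smul_const z.1.2).const_add z.1.1
  rw [one_smul] at h2
  exact h2.hasDerivWithinAt.add (h1.smul_const _)

lemma memLp_of_norm_le {f : ℝ → E d} (hf : Measurable f) {C : ℝ}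
    (hC : ∀ t ∈ Icc (-1) T, ‖f t‖ ≤ C) : MemLp f 2 (timeMeasure T) := by
  refine MemLp.of_bound hf.aestronglyMeasurable C ?_
  filter_upwards [ae_restrict_mem measurableSet_Ioo] with t ht
  exact hC t (Ioo_subset_Icc_self ht)

lemma memLp_path (T : ℝ) (z : StatePair d) : MemLp (path z) 2 (timeMeasure T) := by
  obtain ⟨C, hC⟩ := isCompact_Icc.exists_bound_of_continuousOn
    (s := Icc (-1) T) (continuous_path z).continuousOn
  exact memLp_of_norm_le (continuous_path z).measurable hC

lemma norm_pathVelocity_le (z : StatePair d) (t : ℝ) :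
    ‖pathVelocity z t‖ ≤ ‖z.1.2‖ + ‖(1 / 2 : ℝ) • (z.2.2 - z.1.2)‖ := by
  unfold pathVelocity
  split_ifs
  · rw [one_smul]
    exact norm_add_le _ _
  · rw [zero_smul, add_zero]
    exact le_add_of_nonneg_right (norm_nonneg _)

lemma memLp_pathVelocity (T : ℝ) (z : StatePair d) :
    MemLp (pathVelocity z) 2 (timeMeasure T) :=
  memLp_of_norm_le (measurable_pathVelocity.comp measurable_prodMk_left)
    fun t _ => norm_pathVelocity_le z t

lemma path_of_nonpos (z : StatePair d) {t : ℝ} (ht : t ≤ 0) : path z t = z.1.1 + t • z.1.2 := by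
  rw [path, max_eq_right (by linarith [meetingTime_nonneg z]), zero_smul, add_zero]

/-- `path` as an element of the space of curves. -/
def stickyCurve (T : ℝ) (z : StatePair d) : Curve d T :=
  ⟨(memLp_path T z).toLp (path z), z.1, by
    filter_upwards [ae_restrict_of_ae (memLp_path T z).coeFn_toLp,
      ae_restrict_mem measurableSet_Ioo] with t h1 h2
    rw [h1, path_of_nonpos z h2.2.le]⟩

lemma stickyCurve_ae_eq (T : ℝ) (z : StatePair d) :
    ((stickyCurve T z : Curve d T) : L2Curve d T) =ᵐ[timeMeasure T] path z :=
  (memLp_path T z).coeFn_toLp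

lemma measurable_stickyCurve (T : ℝ) : Measurable (stickyCurve (d := d) T) := by
  borelize (L2Curve d T)
  have h : MeasurableEmbedding (Subtype.val : Curve d T → L2Curve d T) :=
    continuous_subtype_val.measurableEmbedding Subtype.val_injective
  exact h.measurable_comp_iff.1 (measurable_toLp measurable_path (memLp_path T))

lemma stickyCurve_affineStart (z : StatePair d) :
    ∀ᵐ s ∂(timeMeasure T).restrict (Ioo (-1) 0),
      ((stickyCurve T z : Curve d T) : L2Curve d T) s = z.1.1 + s • z.1.2 := by
  filter_upwards [ae_restrict_of_ae (stickyCurve_ae_eq T z),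
    ae_restrict_mem measurableSet_Ioo] with t h1 h2
  rw [h1, path_of_nonpos z h2.2.le]

lemma e₀_stickyCurve (hT : 0 < T) (z : StatePair d) : e₀ (stickyCurve T z) = z.1.1 :=
  e₀_eq_of_affine hT (stickyCurve_affineStart z)

lemma W₀_stickyCurve (hT : 0 < T) (z : StatePair d) : W₀ (stickyCurve T z) = z.1.2 :=
  W₀_eq_of_affine hT (stickyCurve_affineStart z)

lemma velocity_stickyCurve (z : StatePair d) {t : ℝ} (ht : -1 ≤ t) (htT : t < T) :
    velocity t (stickyCurve T z) = pathVelocity z t := by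
  rcases le_or_gt (meetingTime z) t with h | h
  · rw [pathVelocity, if_pos h, one_smul]
    refine velocity_of_affine (β := T)
      (a := z.1.1 - meetingTime z • ((1 / 2 : ℝ) • (z.2.2 - z.1.2))) ht htT le_rfl ?_
    filter_upwards [stickyCurve_ae_eq T z] with s hs hs'
    rw [hs, path, max_eq_left (by linarith [hs'.1])]
    module
  · rw [pathVelocity, if_neg (not_le.2 h), zero_smul, add_zero]
    refine velocity_of_affine (β := min (meetingTime z) T) (a := z.1.1) ht (lt_min h htT)
      (min_le_right _ _) ?_
    filter_upwards [stickyCurve_ae_eq T z] with s hs hs'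
    rw [hs, path, max_eq_right (by linarith [hs'.2.trans_le (min_le_left _ _)])]
    simp

lemma tail_stickyCurve_swap {z : StatePair d} (hz : z ∈ meetingPairs d T) {t : ℝ}
    (ht : meetingTime z ≤ t) : tail t (stickyCurve T z.swap) = tail t (stickyCurve T z) := by
  refine Lp.ext ((tail_ae_eq _ _).trans (EventuallyEq.trans ?_ (tail_ae_eq _ _).symm))
  filter_upwards [ae_restrict_of_ae (stickyCurve_ae_eq T z),
    ae_restrict_of_ae (stickyCurve_ae_eq T z.swap),
    ae_restrict_mem measurableSet_Ioo] with s h1 h2 hs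
  rw [h1, h2, path_swap hz (ht.trans hs.1.le)]

lemma HasWeakDeriv.congr {f f' g g' : ℝ → E d} (h : HasWeakDeriv T f g)
    (hf : f' =ᵐ[timeMeasure T] f) (hg : g' =ᵐ[timeMeasure T] g) : HasWeakDeriv T f' g' := by
  intro φ h1 h2 h3
  rw [integral_congr_ae (hf.mono fun t ht => by simp only [ht] : (fun t => deriv φ t • f' t)
    =ᵐ[timeMeasure T] fun t => deriv φ t • f t), h φ h1 h2 h3]
  congr 1
  exact integral_congr_ae (hg.mono fun t ht => by simp only [ht])

/-- The fundamental theorem for right derivatives, applied to `φ • path z`, tolerates the kink; the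
boundary terms vanish because `φ` is supported in the open interval. -/
lemma hasWeakDeriv_path (hT : 0 < T) (z : StatePair d) :
    HasWeakDeriv T (path z) (pathVelocity z) := by
  intro φ h1 _ h3
  have hle : (-1 : ℝ) ≤ T := by linarith
  have hφ : Differentiable ℝ φ := h1.differentiable (by simp)
  have hφ' : Continuous (deriv φ) := h1.continuous_deriv (by simp)
  have hv : IntervalIntegrable (fun t => φ t • pathVelocity z t) volume (-1) T := by
    rw [intervalIntegrable_iff_integrableOn_Ioo_of_le hle]
    have hm := (memLp_pathVelocity T z).integrable one_le_two
    obtain ⟨C, hC⟩ := isCompact_Icc.exists_bound_of_continuousOn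
      (s := Icc (-1) T) hφ.continuous.continuousOn
    refine hm.bdd_smul C hφ.continuous.aestronglyMeasurable ?_
    filter_upwards [ae_restrict_mem measurableSet_Ioo] with t ht
    exact hC t (Ioo_subset_Icc_self ht)
  have hp : IntervalIntegrable (fun t => deriv φ t • path z t) volume (-1) T :=
    (hφ'.smul (continuous_path z)).intervalIntegrable _ _
  have key := intervalIntegral.integral_eq_sub_of_hasDeriv_right_of_le hle
    (f := fun t => φ t • path z t) (f' := fun t => φ t • pathVelocity z t + deriv φ t • path z t)
    (hφ.continuous.smul (continuous_path z)).continuousOn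
    (fun t _ => (hφ t).hasDerivAt.hasDerivWithinAt.smul (hasDerivWithinAt_path z t))
    (hv.add hp)
  have e1 : φ T = 0 := image_eq_zero_of_notMem_tsupport fun h => lt_irrefl _ (h3 h).2
  have e2 : φ (-1) = 0 := image_eq_zero_of_notMem_tsupport fun h => lt_irrefl _ (h3 h).1
  rw [intervalIntegral.integral_add hv hp, e1, e2, zero_smul, zero_smul, sub_zero,
    intervalIntegral.integral_of_le hle, intervalIntegral.integral_of_le hle,
    integral_Ioc_eq_integral_Ioo, integral_Ioc_eq_integral_Ioo] at key
  exact eq_neg_of_add_eq_zero_right key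

lemma energy_stickyCurve_le (hT : 0 < T) (z : StatePair d) :
    energy (stickyCurve T z) ≤ ∫⁻ t, ‖pathVelocity z t‖ₑ ^ 2 ∂timeMeasure T := by
  have hm := memLp_pathVelocity T z
  refine (iInf₂_le (hm.toLp _) ((hasWeakDeriv_path hT z).congr (stickyCurve_ae_eq T z)
    hm.coeFn_toLp)).trans_eq ?_
  rw [Lp.enorm_toLp, eLpNorm_eq_lintegral_rpow_enorm_toReal (by norm_num) (by norm_num)]
  simp only [ENNReal.toReal_ofNat, ENNReal.rpow_ofNat]
  rw [← ENNReal.rpow_two, ← ENNReal.rpow_mul]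
  norm_num

lemma enorm_sq_eq_ofReal (x : E d) : ‖x‖ₑ ^ 2 = ENNReal.ofReal (‖x‖ ^ 2) := by
  rw [ENNReal.ofReal_pow (norm_nonneg x), ofReal_norm]

/-- Sticking may speed up one particle, but by the parallelogram law it does not raise the kinetic
energy of the pair. -/
lemma enorm_pathVelocity_sq_add_le (z : StatePair d) (t : ℝ) :
    ‖pathVelocity z t‖ₑ ^ 2 + ‖pathVelocity z.swap t‖ₑ ^ 2 ≤ ‖z.1.2‖ₑ ^ 2 + ‖z.2.2‖ₑ ^ 2 := by
  simp only [pathVelocity, meetingTime_swap, Prod.fst_swap, Prod.snd_swap]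
  split_ifs
  · have e1 : z.1.2 + (1 : ℝ) • ((1 / 2 : ℝ) • (z.2.2 - z.1.2)) =
        (1 / 2 : ℝ) • (z.1.2 + z.2.2) := by module
    have e2 : z.2.2 + (1 : ℝ) • ((1 / 2 : ℝ) • (z.1.2 - z.2.2)) =
        (1 / 2 : ℝ) • (z.1.2 + z.2.2) := by module
    rw [e1, e2]
    simp only [enorm_sq_eq_ofReal]
    rw [← ENNReal.ofReal_add (by positivity) (by positivity),
      ← ENNReal.ofReal_add (by positivity) (by positivity)]
    refine ENNReal.ofReal_le_ofReal ?_
    rw [norm_smul]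
    have := parallelogram_law_with_norm ℝ z.1.2 z.2.2
    norm_num
    nlinarith [sq_nonneg ‖z.1.2 - z.2.2‖]
  · simp

end StickyPairs

/-! ### Symmetric couplings of meeting particles yield dissipative solutions -/

section StickyMeasures

open Filter Topology

variable {d : ℕ} {T : ℝ}

instance instStandardBorelSpaceStatePair (d : ℕ) : StandardBorelSpace (StatePair d) :=
  have : StandardBorelSpace (E d × E d) := inferInstance
  StandardBorelSpace.prod

/-- Almost every point with respect to an image measure is the image of a point. -/
lemma ae_map_exists_preimage {X Y : Type*} [MeasurableSpace X] [StandardBorelSpace X]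
    [MeasurableSpace Y] [StandardBorelSpace Y] [Nonempty X] {θ : Measure X} [IsFiniteMeasure θ]
    {Φ : X → Y} (hΦ : Measurable Φ) {p : X → Prop} (hp : MeasurableSet {x | p x})
    (h : ∀ᵐ x ∂θ, p x) : ∀ᵐ y ∂θ.map Φ, ∃ x, p x ∧ Φ x = y := by
  -- Disintegrate `θ` along `Φ`: almost every fibre measure is a probability concentrated on the
  -- points of the fibre where `p` holds, so such a point exists.
  have h1 : ∀ᵐ w ∂(θ.map Φ) ⊗ₘ condDistrib id Φ θ, p w.2 ∧ Φ w.2 = w.1 := by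
    have hs : MeasurableSet {w : Y × X | p w.2 ∧ Φ w.2 = w.1} :=
      (measurable_snd hp).inter (measurableSet_eq_fun (by fun_prop) (by fun_prop))
    rw [compProd_map_condDistrib aemeasurable_id, ae_map_iff (by fun_prop) hs]
    exact h.mono fun x hx => ⟨hx, rfl⟩
  filter_upwards [Measure.ae_ae_of_ae_compProd h1] with y hy
  exact hy.exists

lemma memLp_two_of_lintegral_le {Ω : Type*} [MeasurableSpace Ω] {μ : Measure Ω} {f : Ω → E d}
    (hf : Measurable f) {C : ℝ≥0∞} (hC : C < ⊤) (h : ∫⁻ x, ‖f x‖ₑ ^ 2 ∂μ ≤ C) : MemLp f 2 μ := by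
  refine ⟨hf.aestronglyMeasurable, ?_⟩
  rw [eLpNorm_eq_lintegral_rpow_enorm_toReal (by norm_num) (by norm_num)]
  simp only [ENNReal.toReal_ofNat, ENNReal.rpow_ofNat]
  exact ENNReal.rpow_lt_top_of_nonneg (by norm_num) (h.trans_lt hC).ne

lemma HasInitialDatum.memLp_W₀ (hT : 0 < T) {η : ProbabilityMeasure (Curve d T)}
    {ν₀ : ProbabilityMeasure (E d × E d)} (h : HasInitialDatum η ν₀) (hν : ν₀ ∈ P₂₁ d) :
    MemLp W₀ 2 (η : Measure (Curve d T)) := by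
  refine memLp_two_of_lintegral_le (measurable_W₀ hT) ENNReal.one_lt_top (le_trans ?_ hν.2)
  rw [← show _ = (ν₀ : Measure (E d × E d)) from h,
    lintegral_map (by fun_prop) ((measurable_e₀ hT).prodMk (measurable_W₀ hT))]

/-- `V_t` is the conditional expectation of the initial velocity given the curve after `t`. -/
lemma V_ae_eq_condExp {η : ProbabilityMeasure (Curve d T)}
    (hη : Integrable W₀ (η : Measure (Curve d T))) (t : ℝ) :
    V η t =ᵐ[(η : Measure (Curve d T))]
      (η : Measure (Curve d T))[W₀ | MeasurableSpace.comap (tail t) inferInstance] :=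
  (condExp_ae_eq_integral_condDistrib_id (measurable_tail t) hη).symm

/-- Couplings of `ν₀` with itself, invariant under exchange, of particles which meet before `T`. -/
structure IsMeetingCoupling (T : ℝ) (θ : ProbabilityMeasure (StatePair d))
    (ν₀ : ProbabilityMeasure (E d × E d)) : Prop where
  map_swap : (θ : Measure (StatePair d)).map Prod.swap = θ
  map_fst : (θ : Measure (StatePair d)).map Prod.fst = ν₀
  ae_mem : ∀ᵐ z ∂(θ : Measure (StatePair d)), z ∈ meetingPairs d T

/-- The law of the first particle of a random pair. -/
def stickyMeasure (T : ℝ) (θ : ProbabilityMeasure (StatePair d)) :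
    ProbabilityMeasure (Curve d T) :=
  θ.map (measurable_stickyCurve T).aemeasurable

lemma coe_stickyMeasure (T : ℝ) (θ : ProbabilityMeasure (StatePair d)) :
    (stickyMeasure T θ : Measure (Curve d T)) =
      (θ : Measure (StatePair d)).map (stickyCurve T) := rfl

variable {θ : ProbabilityMeasure (StatePair d)} {ν₀ : ProbabilityMeasure (E d × E d)}

lemma IsMeetingCoupling.lintegral_swap (h : IsMeetingCoupling T θ ν₀) {f : StatePair d → ℝ≥0∞}
    (hf : Measurable f) :
    ∫⁻ z, f z.swap ∂(θ : Measure (StatePair d)) = ∫⁻ z, f z ∂(θ : Measure (StatePair d)) := by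
  conv_rhs => rw [← h.map_swap]
  rw [lintegral_map hf measurable_swap]

lemma IsMeetingCoupling.lintegral_fst (h : IsMeetingCoupling T θ ν₀) {f : E d × E d → ℝ≥0∞}
    (hf : Measurable f) :
    ∫⁻ z, f z.1 ∂(θ : Measure (StatePair d)) = ∫⁻ p, f p ∂(ν₀ : Measure (E d × E d)) := by
  rw [← h.map_fst, lintegral_map hf measurable_fst]

lemma IsMeetingCoupling.hasInitialDatum (hT : 0 < T) (h : IsMeetingCoupling T θ ν₀) :
    HasInitialDatum (stickyMeasure T θ) ν₀ := by
  rw [HasInitialDatum, coe_stickyMeasure, Measure.map_map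
    ((measurable_e₀ hT).prodMk (measurable_W₀ hT)) (measurable_stickyCurve T), ← h.map_fst]
  congr 1
  funext z
  simp [e₀_stickyCurve hT, W₀_stickyCurve hT]

/-- The energy bound holds only for the pair; exchange symmetry lets each particle carry half of it.
-/
lemma IsMeetingCoupling.lintegral_pathVelocity_le (h : IsMeetingCoupling T θ ν₀)
    (hν : ν₀ ∈ P₂₁ d) (t : ℝ) :
    ∫⁻ z, ‖pathVelocity z t‖ₑ ^ 2 ∂(θ : Measure (StatePair d)) ≤ 1 := by
  have hm : Measurable fun z : StatePair d => ‖pathVelocity z t‖ₑ ^ 2 :=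
    ((measurable_pathVelocity.comp measurable_prodMk_right).enorm).pow_const 2
  have hm' : Measurable fun z : StatePair d => ‖z.1.2‖ₑ ^ 2 := by fun_prop
  have h1 : ∫⁻ z, ‖z.1.2‖ₑ ^ 2 ∂(θ : Measure (StatePair d)) ≤ 1 :=
    (h.lintegral_fst (f := fun p => ‖p.2‖ₑ ^ 2) (by fun_prop)).trans_le hν.2
  have h2 : ∫⁻ z, ‖z.2.2‖ₑ ^ 2 ∂(θ : Measure (StatePair d)) ≤ 1 :=
    (h.lintegral_swap hm').trans_le h1
  have h3 : 2 * ∫⁻ z, ‖pathVelocity z t‖ₑ ^ 2 ∂(θ : Measure (StatePair d)) ≤ 2 * 1 := by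
    calc 2 * ∫⁻ z, ‖pathVelocity z t‖ₑ ^ 2 ∂(θ : Measure (StatePair d))
        = ∫⁻ z, (‖pathVelocity z t‖ₑ ^ 2 + ‖pathVelocity z.swap t‖ₑ ^ 2)
            ∂(θ : Measure (StatePair d)) := by
          rw [lintegral_add_left hm, h.lintegral_swap hm, two_mul]
      _ ≤ ∫⁻ z, (‖z.1.2‖ₑ ^ 2 + ‖z.2.2‖ₑ ^ 2) ∂(θ : Measure (StatePair d)) :=
          lintegral_mono fun z => enorm_pathVelocity_sq_add_le z t
      _ ≤ 2 * 1 := by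
          rw [lintegral_add_left hm', two_mul]
          exact add_le_add h1 h2
  exact (ENNReal.mul_le_mul_iff_right (by norm_num) (by norm_num)).1 h3

lemma IsMeetingCoupling.mem_finiteEnergyMeasures (hT : 0 < T) (h : IsMeetingCoupling T θ ν₀)
    (hν : ν₀ ∈ P₂₁ d) : stickyMeasure T θ ∈ finiteEnergyMeasures d T := by
  constructor
  · rw [coe_stickyMeasure, lintegral_map ((measurable_e₀ hT).enorm.pow_const 2)
      (measurable_stickyCurve T)]
    simp_rw [e₀_stickyCurve hT]
    exact (h.lintegral_fst (f := fun p => ‖p.1‖ₑ ^ 2) (by fun_prop)).trans_le hν.1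
  · rw [coe_stickyMeasure]
    have hm : Measurable fun w : StatePair d × ℝ => ‖pathVelocity w.1 w.2‖ₑ ^ 2 :=
      measurable_pathVelocity.enorm.pow_const 2
    -- This inequality for image measures needs no measurability of `energy`, which is an
    -- uncountable infimum.
    calc _ ≤ ∫⁻ z, energy (stickyCurve T z) ∂(θ : Measure (StatePair d)) := lintegral_map_le _ _
      _ ≤ ∫⁻ z, ∫⁻ t, ‖pathVelocity z t‖ₑ ^ 2 ∂timeMeasure T ∂(θ : Measure (StatePair d)) :=
          lintegral_mono fun z => energy_stickyCurve_le hT z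
      _ = ∫⁻ t, ∫⁻ z, ‖pathVelocity z t‖ₑ ^ 2 ∂(θ : Measure (StatePair d)) ∂timeMeasure T :=
          lintegral_lintegral_swap hm.aemeasurable
      _ ≤ ∫⁻ _, 1 ∂timeMeasure T :=
          lintegral_mono fun t => h.lintegral_pathVelocity_le hν t
      _ = 1 + ENNReal.ofReal T := by
          rw [lintegral_one, Measure.restrict_apply_univ, Real.volume_Ioo, sub_neg_eq_add,
            add_comm, ENNReal.ofReal_add zero_le_one hT.le, ENNReal.ofReal_one]

lemma isVelocity_stickyMeasure (hT : 0 < T) (θ : ProbabilityMeasure (StatePair d)) :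
    IsVelocity (stickyMeasure T θ) velocity := by
  refine ⟨measurable_velocity, ?_⟩
  rw [coe_stickyMeasure]
  filter_upwards [ae_map_exists_preimage (measurable_stickyCurve T) (p := fun _ => True)
    (by simp) (Eventually.of_forall fun _ => trivial)] with γ hγ
  obtain ⟨z, -, rfl⟩ := hγ
  have h : (fun t => velocity t (stickyCurve T z)) =ᵐ[timeMeasure T] pathVelocity z := by
    filter_upwards [ae_restrict_mem measurableSet_Ioo] with t ht
    exact velocity_stickyCurve z ht.1.le ht.2
  exact ⟨(memLp_pathVelocity T z).ae_eq h.symm,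
    (hasWeakDeriv_path hT z).congr (stickyCurve_ae_eq T z) h⟩

lemma IsMeetingCoupling.memLp_pathVelocity (h : IsMeetingCoupling T θ ν₀) (hν : ν₀ ∈ P₂₁ d)
    (t : ℝ) : MemLp (fun z => pathVelocity z t) 2 (θ : Measure (StatePair d)) :=
  memLp_two_of_lintegral_le (measurable_pathVelocity.comp measurable_prodMk_right)
    ENNReal.one_lt_top (h.lintegral_pathVelocity_le hν t)

/-- The difference of the integrands vanishes before the meeting. Afterwards it changes sign under
exchange while the tail event is invariant. As `θ` is symmetric, the integral of the difference
equals its own negative. -/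
lemma IsMeetingCoupling.setIntegral_pathVelocity (h : IsMeetingCoupling T θ ν₀)
    (hν : ν₀ ∈ P₂₁ d) {t : ℝ} {B : Set (TailCurve d T t)}
    (hB : MeasurableSet B) :
    ∫ z in (fun z => tail t (stickyCurve T z)) ⁻¹' B, pathVelocity z t
      ∂(θ : Measure (StatePair d)) =
    ∫ z in (fun z => tail t (stickyCurve T z)) ⁻¹' B, z.1.2 ∂(θ : Measure (StatePair d)) := by
  have hS : MeasurableSet ((fun z : StatePair d => tail t (stickyCurve T z)) ⁻¹' B) :=
    ((measurable_tail t).comp (measurable_stickyCurve T)) hB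
  have i1 := (h.memLp_pathVelocity hν t).integrable one_le_two
  have i2 : Integrable (fun z : StatePair d => z.1.2) (θ : Measure (StatePair d)) :=
    (memLp_two_of_lintegral_le (by fun_prop) ENNReal.one_lt_top
      ((h.lintegral_fst (f := fun p => ‖p.2‖ₑ ^ 2) (by fun_prop)).trans_le hν.2)).integrable
      one_le_two
  rw [← sub_eq_zero, ← integral_sub i1.integrableOn i2.integrableOn, ← integral_indicator hS]
  set g : StatePair d → E d := ((fun z => tail t (stickyCurve T z)) ⁻¹' B).indicator
    fun z => pathVelocity z t - z.1.2 with hg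
  have hgm : Measurable g := Measurable.indicator
    ((measurable_pathVelocity.comp measurable_prodMk_right).sub (by fun_prop)) hS
  have e1 : ∫ z, g z ∂(θ : Measure (StatePair d)) =
      ∫ z, g z.swap ∂(θ : Measure (StatePair d)) := by
    conv_lhs => rw [← h.map_swap]
    exact integral_map measurable_swap.aemeasurable hgm.aestronglyMeasurable
  have e2 : ∫ z, g z.swap ∂(θ : Measure (StatePair d)) =
      ∫ z, -g z ∂(θ : Measure (StatePair d)) := by
    refine integral_congr_ae ?_
    filter_upwards [h.ae_mem] with z hz
    by_cases ht : meetingTime z ≤ t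
    · have hiff : z.swap ∈ (fun z => tail t (stickyCurve T z)) ⁻¹' B ↔
          z ∈ (fun z => tail t (stickyCurve T z)) ⁻¹' B := by
        simp only [mem_preimage, tail_stickyCurve_swap hz ht]
      by_cases hzB : z ∈ (fun z => tail t (stickyCurve T z)) ⁻¹' B
      · rw [hg, indicator_of_mem hzB, indicator_of_mem (hiff.2 hzB)]
        simp only [pathVelocity, meetingTime_swap, if_pos ht, Prod.fst_swap, Prod.snd_swap]
        module
      · rw [hg, indicator_of_notMem hzB, indicator_of_notMem (mt hiff.1 hzB), neg_zero]
    · have hz0 : ∀ w : StatePair d, meetingTime w = meetingTime z → g w = 0 := by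
        intro w hw
        rw [hg, indicator_apply_eq_zero]
        intro _
        simp [pathVelocity, hw, ht]
      rw [hz0 z rfl, hz0 z.swap (meetingTime_swap z), neg_zero]
  rw [e2, integral_neg] at e1
  have h2 : (2 : ℝ) • ∫ z, g z ∂(θ : Measure (StatePair d)) = 0 := by
    rw [two_smul]
    exact eq_neg_iff_add_eq_zero.1 e1
  exact (smul_eq_zero.1 h2).resolve_left two_ne_zero

/-- The velocity at `t` is tail-measurable and has the integrals of `W₀` over tail events, which
characterizes the conditional expectation. -/
lemma IsMeetingCoupling.velocity_ae_eq_V (hT : 0 < T) (h : IsMeetingCoupling T θ ν₀)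
    (hν : ν₀ ∈ P₂₁ d) {t : ℝ} (ht0 : 0 ≤ t) (htT : t < T) :
    velocity t =ᵐ[(stickyMeasure T θ : Measure (Curve d T))] V (stickyMeasure T θ) t := by
  have hW := ((h.hasInitialDatum hT).memLp_W₀ hT hν).integrable one_le_two
  have hvm : Measurable (velocity (d := d) (T := T) t) :=
    measurable_velocity.of_uncurry_left
  have hvΦ : ∀ z : StatePair d, velocity t (stickyCurve T z) = pathVelocity z t := fun z =>
    velocity_stickyCurve z (by linarith) htT
  have hv : Integrable (velocity t) (stickyMeasure T θ : Measure (Curve d T)) := by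
    rw [coe_stickyMeasure, integrable_map_measure hvm.aestronglyMeasurable
      (measurable_stickyCurve T).aemeasurable]
    simp only [Function.comp_def, hvΦ]
    exact (h.memLp_pathVelocity hν t).integrable one_le_two
  refine EventuallyEq.trans ?_ (V_ae_eq_condExp hW t).symm
  refine ae_eq_condExp_of_forall_setIntegral_eq (measurable_tail t).comap_le hW
    (fun s _ _ => hv.integrableOn) ?_
    (stronglyMeasurable_velocity_comap_tail t).aestronglyMeasurable
  rintro s ⟨B, hB, rfl⟩ -
  have hB' : MeasurableSet (tail t ⁻¹' B : Set (Curve d T)) := measurable_tail t hB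
  rw [coe_stickyMeasure, setIntegral_map hB' hvm.aestronglyMeasurable
    (measurable_stickyCurve T).aemeasurable, setIntegral_map hB'
    (measurable_W₀ hT).aestronglyMeasurable (measurable_stickyCurve T).aemeasurable]
  simp_rw [hvΦ, W₀_stickyCurve hT]
  exact h.setIntegral_pathVelocity hν hB

theorem IsMeetingCoupling.isDissipative (hT : 0 < T) (h : IsMeetingCoupling T θ ν₀)
    (hν : ν₀ ∈ P₂₁ d) : IsDissipative (stickyMeasure T θ) := by
  refine ⟨h.mem_finiteEnergyMeasures hT hν, velocity, isVelocity_stickyMeasure hT θ, ?_⟩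
  -- The right derivative needs some time left after `t`, so the null time `T` is dropped.
  rw [← Measure.restrict_congr_set Ico_ae_eq_Icc]
  filter_upwards [ae_restrict_mem measurableSet_Ico] with t ht
  exact h.velocity_ae_eq_V hT hν ht.1 ht.2

end StickyMeasures

/-! ### Zero dissipation forces straight lines -/

section Rigidity

open Filter Topology

variable {d : ℕ} {T : ℝ}

lemma integrable_smul_of_continuous {φ : ℝ → ℝ} (hφ : Continuous φ) {f : ℝ → E d}
    (hf : Integrable f (timeMeasure T)) : Integrable (fun t => φ t • f t) (timeMeasure T) := by
  obtain ⟨C, hC⟩ := isCompact_Icc.exists_bound_of_continuousOn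
    (s := Icc (-1) T) hφ.continuousOn
  refine hf.bdd_smul C hφ.aestronglyMeasurable ?_
  filter_upwards [ae_restrict_mem measurableSet_Ioo] with t ht
  exact hC t (Ioo_subset_Icc_self ht)

lemma HasWeakDeriv.sub {f f' g g' : ℝ → E d} (h : HasWeakDeriv T f g) (h' : HasWeakDeriv T f' g')
    (hf : Integrable f (timeMeasure T)) (hf' : Integrable f' (timeMeasure T))
    (hg : Integrable g (timeMeasure T)) (hg' : Integrable g' (timeMeasure T)) :
    HasWeakDeriv T (f - f') (g - g') := by
  intro φ h1 h2 h3
  have hφ : Continuous φ := h1.continuous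
  have hφ' : Continuous (deriv φ) := h1.continuous_deriv (by simp)
  simp only [Pi.sub_apply, smul_sub]
  rw [integral_sub (integrable_smul_of_continuous hφ' hf) (integrable_smul_of_continuous hφ' hf'),
    integral_sub (integrable_smul_of_continuous hφ hg) (integrable_smul_of_continuous hφ hg'),
    h φ h1 h2 h3, h' φ h1 h2 h3]
  abel

lemma smul_ae_eq_zero {φ : ℝ → ℝ} {f : ℝ → E d}
    (hφ : ∀ t, t ∉ Ioo (-1 : ℝ) 0 → φ t = 0)
    (hf : ∀ᵐ t ∂timeMeasure T, t ∈ Ioo (-1) 0 → f t = 0) :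
    (fun t => φ t • f t) =ᵐ[timeMeasure T] 0 := by
  filter_upwards [hf] with t ht
  by_cases h : t ∈ Ioo (-1 : ℝ) 0
  · simp [ht h]
  · simp [hφ t h]

/-- A compactly supported smooth function whose integral vanishes has a compactly supported
smooth primitive. -/
lemma exists_primitive_of_integral_eq_zero {θ : ℝ → ℝ} (hθ : ContDiff ℝ ∞ θ)
    (hc : HasCompactSupport θ) (hsupp : tsupport θ ⊆ Ioo (-1) T) (hint : ∫ t, θ t = 0) :
    ∃ Θ : ℝ → ℝ, ContDiff ℝ ∞ Θ ∧ HasCompactSupport Θ ∧ tsupport Θ ⊆ Ioo (-1) T ∧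
      deriv Θ = θ := by
  rcases (tsupport θ).eq_empty_or_nonempty with hemp | hne
  · have h0 : θ = 0 := tsupport_eq_empty_iff.1 hemp
    exact ⟨0, contDiff_const, HasCompactSupport.zero, by simp [tsupport_eq_empty_iff.2 rfl], by
      rw [h0]; exact funext fun x => by simp⟩
  obtain ⟨α, hα, hαmin⟩ := hc.isCompact.exists_isLeast hne
  obtain ⟨β, hβ, hβmax⟩ := hc.isCompact.exists_isGreatest hne
  have hα1 := (hsupp hα).1
  have hβT := (hsupp hβ).2
  have hlt : ∀ t, t < α → θ t = 0 := fun t ht =>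
    image_eq_zero_of_notMem_tsupport fun h => absurd (hαmin h) (not_le.2 ht)
  have hgt : ∀ t, β < t → θ t = 0 := fun t ht =>
    image_eq_zero_of_notMem_tsupport fun h => absurd (hβmax h) (not_le.2 ht)
  have hderiv : ∀ t, HasDerivAt (fun t => ∫ s in (-1)..t, θ s) (θ t) t := fun t =>
    hθ.continuous.integral_hasStrictDerivAt (-1) t |>.hasDerivAt
  have hd : deriv (fun t => ∫ s in (-1)..t, θ s) = θ := funext fun t => (hderiv t).deriv
  have hsub : tsupport (fun t => ∫ s in (-1)..t, θ s) ⊆ Icc α β := by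
    refine closure_minimal (fun t ht => ?_) isClosed_Icc
    by_contra hcon
    refine ht ?_
    rw [mem_Icc, not_and_or, not_le, not_le] at hcon
    rcases hcon with h | h
    · refine intervalIntegral.integral_zero_ae (Eventually.of_forall fun s hs => hlt s ?_)
      rcases le_total (-1) t with h' | h'
      · rw [uIoc_of_le h'] at hs
        linarith [hs.2]
      · rw [uIoc_of_ge h'] at hs
        linarith [hs.2]
    · have hαβ : α ≤ β := hαmin hβ
      change ∫ s in (-1)..t, θ s = 0
      rw [← hint, intervalIntegral.integral_of_le (by linarith)]
      refine setIntegral_eq_integral_of_forall_compl_eq_zero fun s hs => ?_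
      rw [mem_Ioc, not_and_or, not_lt, not_le] at hs
      rcases hs with hs | hs
      · exact hlt s (by linarith)
      · exact hgt s (by linarith)
  refine ⟨fun t => ∫ s in (-1)..t, θ s, ?_, ?_, ?_, hd⟩
  · rw [contDiff_infty_iff_deriv, hd]
    exact ⟨fun t => (hderiv t).differentiableAt, hθ⟩
  · exact HasCompactSupport.intro isCompact_Icc fun t ht =>
      image_eq_zero_of_notMem_tsupport (f := fun t => ∫ s in (-1)..t, θ s) fun h => ht (hsub h)
  · exact hsub.trans fun t ht => ⟨by linarith [ht.1], by linarith [ht.2]⟩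

/-- A function which vanishes on `(-1, 0)` and whose weak derivative vanishes on `(0, T)` is
zero. -/
lemma HasWeakDeriv.ae_eq_zero (hT : 0 < T) {f g : ℝ → E d} (h : HasWeakDeriv T f g)
    (hf : Integrable f (timeMeasure T)) (hg : Integrable g (timeMeasure T))
    (hf0 : ∀ᵐ t ∂timeMeasure T, t ∈ Ioo (-1) 0 → f t = 0)
    (hg0 : ∀ᵐ t ∂timeMeasure T, t ∈ Icc 0 T → g t = 0) : f =ᵐ[timeMeasure T] 0 := by
  -- Testing inside `(-1, 0)`, where `f = 0`, shows that `g` vanishes there too.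
  have hg1 : ∀ᵐ t ∂timeMeasure T, t ∈ Ioo (-1) 0 → g t = 0 := by
    refine isOpen_Ioo.ae_eq_zero_of_integral_contDiff_smul_eq_zero
      hg.integrableOn.locallyIntegrableOn ?_
    intro φ h1 h2 h3
    have h4 := h φ h1 h2 (h3.trans (Ioo_subset_Ioo_right hT.le))
    have h5 : ∀ t, t ∉ Ioo (-1 : ℝ) 0 → deriv φ t = 0 := fun t ht =>
      image_eq_zero_of_notMem_tsupport fun h6 => ht (h3 (tsupport_deriv_subset h6))
    rw [integral_congr_ae (smul_ae_eq_zero h5 hf0)] at h4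
    simpa using h4.symm
  have hgz : g =ᵐ[timeMeasure T] 0 := by
    filter_upwards [hg0, hg1, ae_restrict_mem measurableSet_Ioo] with t h1 h2 h3
    rcases le_or_gt 0 t with h4 | h4
    · exact h1 ⟨h4, h3.2.le⟩
    · exact h2 ⟨h3.1, h4⟩
  have hder : ∀ φ : ℝ → ℝ, ContDiff ℝ ∞ φ → HasCompactSupport φ → tsupport φ ⊆ Ioo (-1) T →
      ∫ t in Ioo (-1) T, deriv φ t • f t = 0 := by
    intro φ h1 h2 h3
    rw [h φ h1 h2 h3, integral_congr_ae (hgz.mono fun t ht => by simp only [ht] :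
      (fun t => φ t • g t) =ᵐ[timeMeasure T] fun t => φ t • (0 : ℝ → E d) t)]
    simp
  have hz : ∀ᵐ t ∂timeMeasure T, t ∈ Ioo (-1) T → f t = 0 := by
    refine isOpen_Ioo.ae_eq_zero_of_integral_contDiff_smul_eq_zero
      hf.integrableOn.locallyIntegrableOn ?_
    intro φ h1 h2 h3
    -- As in du Bois-Reymond's lemma, `φ` minus its mean times a unit bump is the derivative of a
    -- test function. The bump sits in `(-1, 0)`, where `f = 0`, so the constant of integration is
    -- zero.
    let B : ContDiffBump (-1 / 2 : ℝ) := ⟨1 / 8, 1 / 4, by norm_num, by norm_num⟩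
    let ψ : ℝ → ℝ := B.normed volume
    have hψ1 : ContDiff ℝ ∞ ψ := B.contDiff_normed
    have hψ2 : HasCompactSupport ψ := B.hasCompactSupport_normed
    have hψ3 : tsupport ψ ⊆ Ioo (-1) 0 := by
      rw [B.tsupport_normed_eq, Real.closedBall_eq_Icc]
      intro t ht
      have h5 := ht.1
      have h6 := ht.2
      simp only [B] at h5 h6
      exact ⟨by linarith, by linarith⟩
    have hψ4 : ∫ t, ψ t = 1 := B.integral_normed
    set c := ∫ t, φ t with hc
    have hφi : Integrable φ := h1.continuous.integrable_of_hasCompactSupport h2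
    have hψi : Integrable ψ := hψ1.continuous.integrable_of_hasCompactSupport hψ2
    obtain ⟨Θ, hΘ1, hΘ2, hΘ3, hΘ4⟩ := exists_primitive_of_integral_eq_zero (T := T)
      (θ := fun t => φ t - c * ψ t) (h1.sub (contDiff_const.mul hψ1))
      (h2.sub hψ2.mul_left)
      ((tsupport_sub _ _).trans (union_subset h3 ((tsupport_mul_subset_right).trans
        (hψ3.trans (Ioo_subset_Ioo_right hT.le)))))
      (by rw [integral_sub hφi (hψi.const_mul c), integral_const_mul, hψ4]; simp [hc])
    have h6 := hder Θ hΘ1 hΘ2 hΘ3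
    have h7 : ∀ t, t ∉ Ioo (-1 : ℝ) 0 → (c * ψ t) = 0 := fun t ht => by
      rw [image_eq_zero_of_notMem_tsupport fun h8 => ht (hψ3 h8), mul_zero]
    simp only [hΘ4, sub_smul] at h6
    rw [integral_sub (integrable_smul_of_continuous h1.continuous hf)
      (integrable_smul_of_continuous (by fun_prop) hf),
      integral_congr_ae (smul_ae_eq_zero h7 hf0)] at h6
    simpa using h6
  filter_upwards [hz, ae_restrict_mem measurableSet_Ioo] with t h1 h2
  exact h1 h2

lemma path_diag (p : E d × E d) (t : ℝ) : path (p, p) t = p.1 + t • p.2 := by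
  simp [path]

lemma pathVelocity_diag (p : E d × E d) (t : ℝ) : pathVelocity (p, p) t = p.2 := by
  simp [pathVelocity]

/-- A curve whose weak derivative is the initial velocity is a straight line. -/
lemma ae_eq_line_of_hasWeakDeriv (hT : 0 < T) {γ : Curve d T} {u : ℝ → E d}
    (hu : MemLp u 2 (timeMeasure T)) (h : HasWeakDeriv T (γ : L2Curve d T) u)
    (huW : ∀ᵐ t ∂volume.restrict (Icc 0 T), u t = W₀ γ) :
    ∀ᵐ t ∂timeMeasure T, (γ : L2Curve d T) t = e₀ γ + t • W₀ γ := by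
  -- The path of a pair of identical particles is the line to be compared with `γ`.
  let z : StatePair d := ((e₀ γ, W₀ γ), (e₀ γ, W₀ γ))
  have h1 := h.sub (hasWeakDeriv_path hT z) (integrable_Lp_two _)
    ((memLp_path T z).integrable one_le_two) (hu.integrable one_le_two)
    ((memLp_pathVelocity T z).integrable one_le_two)
  have h2 := h1.ae_eq_zero hT ((integrable_Lp_two _).sub ((memLp_path T z).integrable one_le_two))
    ((hu.integrable one_le_two).sub ((memLp_pathVelocity T z).integrable one_le_two)) ?_ ?_
  · filter_upwards [h2] with t ht
    rw [Pi.sub_apply, path_diag] at ht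
    exact sub_eq_zero.1 ht
  · filter_upwards [(ae_restrict_iff' measurableSet_Ioo).1 (ae_eq_initialAffine γ)] with t ht ht'
    rw [Pi.sub_apply, path_diag, ht ht', sub_self]
  · filter_upwards [ae_restrict_of_ae ((ae_restrict_iff' measurableSet_Icc).1 huW)] with t ht ht'
    rw [Pi.sub_apply, pathVelocity_diag, ht ht', sub_self]

section CondExp

variable {Ω : Type*} {m m₀ : MeasurableSpace Ω} {μ : Measure Ω} {f : Ω → E d}

lemma integral_norm_sq_toLp (hf : MemLp f 2 μ) : ∫ x, ‖f x‖ ^ 2 ∂μ = ‖hf.toLp f‖ ^ 2 := by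
  rw [← real_inner_self_eq_norm_sq, L2.inner_def]
  refine integral_congr_ae ?_
  filter_upwards [hf.coeFn_toLp] with x hx
  rw [hx, real_inner_self_eq_norm_sq]

/-- Pythagoras' theorem for the conditional expectation. -/
lemma integral_norm_sq_eq_condExp_add [IsFiniteMeasure μ] (hm : m ≤ m₀) (hf : MemLp f 2 μ) :
    ∫ x, ‖f x‖ ^ 2 ∂μ = ∫ x, ‖(μ[f | m]) x‖ ^ 2 ∂μ + ∫ x, ‖f x - (μ[f | m]) x‖ ^ 2 ∂μ := by
  have h1 := hf.condExpL2_ae_eq_condExp (𝕜 := ℝ) hm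
  set P : Lp (E d) 2 μ := (condExpL2 (E d) ℝ hm (hf.toLp f) : Lp (E d) 2 μ) with hP
  have hfm : MemLp (μ[f | m]) 2 μ := (Lp.memLp P).ae_eq h1
  have e1 : hfm.toLp _ = P := Lp.ext (hfm.coeFn_toLp.trans h1.symm)
  have e2 : (hf.sub hfm).toLp _ = hf.toLp f - P := by
    rw [MemLp.toLp_sub hf hfm, e1]
  have e3 := integral_norm_sq_toLp (hf.sub hfm)
  simp only [Pi.sub_apply] at e3
  rw [integral_norm_sq_toLp hf, integral_norm_sq_toLp hfm, e3, e1, e2]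
  have : Fact (m ≤ m₀) := ⟨hm⟩
  -- In `L²` the conditional expectation is an orthogonal projection.
  have key : inner ℝ (hf.toLp f - P) P = 0 :=
    (lpMeas (E d) ℝ m 2 μ).starProjection_inner_eq_zero (hf.toLp f) P
      (condExpL2 (E d) ℝ hm (hf.toLp f)).2
  have := norm_add_sq_eq_norm_sq_add_norm_sq_of_inner_eq_zero _ _ key
  rw [sub_add_cancel] at this
  nlinarith

end CondExp

/-- A dissipative solution without dissipation is concentrated on straight lines. -/
theorem ae_eq_line_of_dissipation_eq_zero (hT : 0 < T) {η : ProbabilityMeasure (Curve d T)}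
    {ν₀ : ProbabilityMeasure (E d × E d)} (hη : IsDissipative η) (h : HasInitialDatum η ν₀)
    (hν : ν₀ ∈ P₂₁ d) (hD : dissipation η = 0) :
    ∀ᵐ (γ : Curve d T) ∂(η : Measure (Curve d T)), ∀ᵐ t ∂timeMeasure T,
      (γ : L2Curve d T) t = e₀ γ + t • W₀ γ := by
  obtain ⟨-, u, ⟨hum, huγ⟩, huV⟩ := hη
  have hW := h.memLp_W₀ hT hν
  set μ := (η : Measure (Curve d T)) with hμ
  have : IsProbabilityMeasure μ := η.2
  have : IsFiniteMeasure μ := IsZeroOrProbabilityMeasure.toIsFiniteMeasure μ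
  have : SigmaFinite μ := IsFiniteMeasure.toSigmaFinite μ
  have hWi : Integrable W₀ μ := hW.integrable one_le_two
  have hpyth : ∀ t, ∫ γ, ‖W₀ γ‖ ^ 2 ∂μ =
      ∫ γ, ‖V η t γ‖ ^ 2 ∂μ + ∫ γ, ‖W₀ γ - V η t γ‖ ^ 2 ∂μ := by
    intro t
    have hV := V_ae_eq_condExp hWi t
    rw [integral_norm_sq_eq_condExp_add (measurable_tail t).comap_le hW]
    congr 1
    · exact integral_congr_ae (hV.mono fun γ hγ => by simp only [hγ, hμ])
    · exact integral_congr_ae (hV.mono fun γ hγ => by simp only [hγ, hμ])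
  have hVL : ∀ t, MemLp (V η t) 2 μ := fun t =>
    (hW.condExp (m := MeasurableSpace.comap (tail t) inferInstance) one_le_two).ae_eq
      (V_ae_eq_condExp hWi t).symm
  -- By `hpyth` the dissipation is the integral of `δ ≥ 0` over `(0, T]`.
  let δ : ℝ → ℝ := fun t => ∫ γ, ‖W₀ γ - V η t γ‖ ^ 2 ∂μ
  have hδ0 : ∀ t, 0 ≤ δ t := fun t => integral_nonneg fun γ => by positivity
  have hδle : ∀ t, δ t ≤ ∫ γ, ‖W₀ γ‖ ^ 2 ∂μ := fun t => by
    rw [hpyth t]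
    exact le_add_of_nonneg_left (integral_nonneg fun γ => by positivity)
  -- `V` is only defined time by time; measurability in `t` comes from the jointly measurable `u`,
  -- which agrees with it almost everywhere. The exchange of quantifiers in `hswap` also rests on
  -- `u`.
  have hδm : AEStronglyMeasurable δ (volume.restrict (Ioc 0 T)) := by
    have hm : StronglyMeasurable fun t : ℝ => ∫ γ, ‖W₀ γ - u t γ‖ ^ 2 ∂μ := by
      refine StronglyMeasurable.integral_prod_right'
        (f := fun q : ℝ × Curve d T => ‖W₀ q.2 - u q.1 q.2‖ ^ 2) (Measurable.stronglyMeasurable ?_)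
      exact ((((measurable_W₀ hT).comp measurable_snd).sub hum).norm).pow_const 2
    refine hm.aestronglyMeasurable.congr ?_
    filter_upwards [ae_restrict_of_ae_restrict_of_subset Ioc_subset_Icc_self huV] with t ht
    exact integral_congr_ae (ht.mono fun γ hγ => by simp only [hγ])
  have hδi : IntegrableOn δ (Ioc 0 T) :=
    Integrable.of_bound hδm (∫ γ, ‖W₀ γ‖ ^ 2 ∂μ)
      (Eventually.of_forall fun t => by rw [Real.norm_of_nonneg (hδ0 t)]; exact hδle t)
  have hδ : ∫ t in Ioc 0 T, δ t = 0 := by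
    rw [dissipation, intervalIntegral.integral_of_le hT.le] at hD
    have e : ∀ t, ∫ γ, ‖V η t γ‖ ^ 2 ∂μ = ∫ γ, ‖W₀ γ‖ ^ 2 ∂μ - δ t := fun t =>
      eq_sub_of_add_eq (hpyth t).symm
    simp_rw [← hμ, e] at hD
    rw [integral_sub (integrable_const _) hδi] at hD
    simpa [hT.le] using hD
  have hδz := (integral_eq_zero_iff_of_nonneg (fun t => hδ0 t) hδi).1 hδ
  have huW : ∀ᵐ t ∂volume.restrict (Icc 0 T), ∀ᵐ γ ∂μ, u t γ = W₀ γ := by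
    rw [← Measure.restrict_congr_set Ioc_ae_eq_Icc] at huV ⊢
    filter_upwards [huV, hδz] with t h1 h2
    have h3 := (integral_eq_zero_iff_of_nonneg (fun γ => by positivity)
      ((hW.sub (hVL t)).integrable_norm_pow two_ne_zero)).1 h2
    filter_upwards [h1, h3] with γ h4 h5
    rw [h4]
    have h6 : ‖W₀ γ - V η t γ‖ ^ 2 = 0 := h5
    rw [sq_eq_zero_iff, norm_eq_zero, sub_eq_zero] at h6
    exact h6.symm
  have hswap : ∀ᵐ γ ∂μ, ∀ᵐ t ∂volume.restrict (Icc 0 T), u t γ = W₀ γ :=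
    (Measure.ae_ae_comm (p := fun t γ => u t γ = W₀ γ) (measurableSet_eq_fun hum ((measurable_W₀ hT).comp measurable_snd))).1 huW
  filter_upwards [huγ, hswap] with γ h1 h2
  exact ae_eq_line_of_hasWeakDeriv hT h1.1 h1.2 h2

end Rigidity

/-! ### Non-crossing initial states and the free flow -/

section FreeFlow

open Filter Topology

variable {d : ℕ} {T : ℝ} {ν₀ : ProbabilityMeasure (E d × E d)}

/-- The sticky curve is almost surely a straight line, so its right derivative at the meeting time
is both the initial and the mean velocity. -/
lemma IsMeetingCoupling.ae_eq_velocity (hT : 0 < T) {θ : ProbabilityMeasure (StatePair d)}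
    (hν : ν₀ ∈ D₀ d T) (h : IsMeetingCoupling T θ ν₀) :
    ∀ᵐ z ∂(θ : Measure (StatePair d)), z.1.2 = z.2.2 := by
  have hη := h.isDissipative hT hν.1
  have hd := h.hasInitialDatum hT
  have h1 := ae_eq_line_of_dissipation_eq_zero hT hη hd hν.1 (hν.2 _ hη hd)
  rw [coe_stickyMeasure] at h1
  filter_upwards [ae_of_ae_map (measurable_stickyCurve T).aemeasurable h1, h.ae_mem] with z hz hm
  rw [e₀_stickyCurve hT, W₀_stickyCurve hT] at hz
  have h0 : -1 ≤ meetingTime z := by linarith [meetingTime_nonneg z]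
  have h2 := velocity_stickyCurve (T := T) z h0 hm.1
  rw [velocity_of_affine h0 hm.1 le_rfl (hz.mono fun s hs _ => hs), pathVelocity, if_pos le_rfl,
    left_eq_add, one_smul, smul_eq_zero, sub_eq_zero] at h2
  exact (h2.resolve_left (by norm_num)).symm

/-- Compact sets exhausting the pairs of particles which meet with different velocities. -/
def crossingCompact (d : ℕ) (T : ℝ) (n : ℕ) : Set (StatePair d) :=
  Prod.fst '' {w : StatePair d × ℝ | w ∈ Metric.closedBall 0 n ×ˢ Icc 0 (T - 1 / ((n : ℝ) + 1)) ∧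
    1 / ((n : ℝ) + 1) ≤ ‖w.1.1.2 - w.1.2.2‖ ∧
    w.1.1.1 + w.2 • w.1.1.2 = w.1.2.1 + w.2 • w.1.2.2}

/-- Keeping the time away from `T` and the relative speed away from `0` makes the conditions closed;
projecting out the time preserves compactness. -/
lemma isCompact_crossingCompact (n : ℕ) : IsCompact (crossingCompact d T n) := by
  refine IsCompact.image ?_ continuous_fst
  refine ((isCompact_closedBall _ _).prod isCompact_Icc).inter_right (IsClosed.inter
    (isClosed_le (f := fun _ => 1 / ((n : ℝ) + 1))
      (g := fun w : StatePair d × ℝ => ‖w.1.1.2 - w.1.2.2‖) (by fun_prop) (by fun_prop))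
    (isClosed_eq (f := fun w : StatePair d × ℝ => w.1.1.1 + w.2 • w.1.1.2)
      (g := fun w => w.1.2.1 + w.2 • w.1.2.2) (by fun_prop) (by fun_prop)))

lemma iUnion_crossingCompact :
    ⋃ n, crossingCompact d T n = {z ∈ meetingPairs d T | z.1.2 ≠ z.2.2} := by
  ext z
  rw [mem_iUnion]
  constructor
  · rintro ⟨n, ⟨z, t⟩, ⟨⟨-, ht⟩, hv, hx⟩, rfl⟩
    have hn : (0 : ℝ) < 1 / ((n : ℝ) + 1) := by positivity
    have hne : z.1.2 ≠ z.2.2 := by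
      intro h
      simp only [h, sub_self, norm_zero] at hv
      linarith
    have hm : meetingTime z = t := meetingTime_eq ht.1 hx hne
    exact ⟨⟨by rw [hm]; linarith [ht.2], by rw [hm]; exact hx⟩, hne⟩
  · rintro ⟨⟨hlt, hx⟩, hne⟩
    have hlim : Tendsto (fun n : ℕ => 1 / ((n : ℝ) + 1)) atTop (𝓝 0) :=
      tendsto_one_div_add_atTop_nhds_zero_nat
    have e1 := hlim.eventually (gt_mem_nhds (norm_pos_iff.2 (sub_ne_zero.2 hne)))
    have e2 := hlim.eventually (gt_mem_nhds (sub_pos.2 hlt))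
    have e3 := tendsto_natCast_atTop_atTop.eventually_ge_atTop ‖z‖
    obtain ⟨n, h1, h2, h3⟩ := (e1.and (e2.and e3)).exists
    refine ⟨n, ⟨z, meetingTime z⟩, ⟨⟨?_, meetingTime_nonneg z, ?_⟩, h1.le, hx⟩, rfl⟩
    · rwa [mem_closedBall_zero_iff]
    · change meetingTime z ≤ _
      linarith

/-- Particles which meet before `T` with different velocities can be paired to produce a coupling
of `ν₀` with itself. -/
lemma exists_isMeetingCoupling (hT : 0 < T) {π : Measure (StatePair d)} [IsFiniteMeasure π]
    (hπ : ∀ᵐ z ∂π, z ∈ meetingPairs d T) (h1 : π.map Prod.fst ≤ ν₀) (h2 : π.map Prod.snd ≤ ν₀) :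
    ∃ θ : ProbabilityMeasure (StatePair d), IsMeetingCoupling T θ ν₀ ∧
      π ≪ (θ : Measure (StatePair d)) := by
  -- `ρ` is the common marginal of the symmetrized `π`; the factor `1/2` keeps it below `ν₀`.
  let ρ : Measure (E d × E d) := (2⁻¹ : ℝ≥0∞) • (π.map Prod.fst + π.map Prod.snd)
  have hρ : ρ ≤ ν₀ := by
    refine Measure.le_iff'.2 fun s => ?_
    calc ρ s = 2⁻¹ * (π.map Prod.fst s + π.map Prod.snd s) := rfl
      _ ≤ 2⁻¹ * ((ν₀ : Measure (E d × E d)) s + (ν₀ : Measure (E d × E d)) s) := by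
          gcongr
      _ = (ν₀ : Measure (E d × E d)) s := by
          rw [← two_mul, ← mul_assoc, ENNReal.inv_mul_cancel (by norm_num) (by norm_num), one_mul]
  have : IsFiniteMeasure ρ := isFiniteMeasure_of_le _ hρ
  have hdiag : Measurable fun p : E d × E d => (p, p) := by fun_prop
  -- The mass `ν₀ - ρ` that `π` leaves unpaired is paired with itself on the diagonal.
  let θ : Measure (StatePair d) := (2⁻¹ : ℝ≥0∞) • (π + π.map Prod.swap) +
    ((ν₀ : Measure (E d × E d)) - ρ).map fun p => (p, p)
  have hfst : θ.map Prod.fst = ν₀ := by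
    simp only [θ]
    rw [Measure.map_add _ _ measurable_fst, Measure.map_smul, Measure.map_add _ _ measurable_fst,
      Measure.map_map measurable_fst measurable_swap, Measure.map_map measurable_fst hdiag]
    have e1 : (Prod.fst ∘ Prod.swap : StatePair d → E d × E d) = Prod.snd := rfl
    have e2 : (Prod.fst ∘ fun p : E d × E d => (p, p)) = id := rfl
    rw [e1, e2, Measure.map_id, add_comm]
    exact Measure.sub_add_cancel_of_le hρ
  have hswap : θ.map Prod.swap = θ := by
    simp only [θ]
    rw [Measure.map_add _ _ measurable_swap, Measure.map_smul,
      Measure.map_add _ _ measurable_swap, Measure.map_map measurable_swap measurable_swap,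
      Measure.map_map measurable_swap hdiag, Prod.swap_swap_eq, Measure.map_id, add_comm π]
    rfl
  have hprob : IsProbabilityMeasure θ := by
    refine ⟨?_⟩
    have : θ.map Prod.fst univ = 1 := by rw [hfst]; exact measure_univ
    rwa [Measure.map_apply measurable_fst .univ, preimage_univ] at this
  refine ⟨⟨θ, hprob⟩, ⟨hswap, hfst, ?_⟩, ?_⟩
  · change ∀ᵐ z ∂θ, z ∈ meetingPairs d T
    rw [ae_add_measure_iff]
    refine ⟨Measure.ae_smul_measure (ae_add_measure_iff.2 ⟨hπ, ?_⟩) _, ?_⟩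
    · refine (ae_map_iff (p := fun z => z ∈ meetingPairs d T) measurable_swap.aemeasurable
        measurableSet_meetingPairs).2 ?_
      exact hπ.mono fun z hz => swap_mem_meetingPairs hz
    · refine (ae_map_iff (p := fun z => z ∈ meetingPairs d T) hdiag.aemeasurable
        measurableSet_meetingPairs).2 ?_
      exact Eventually.of_forall fun p => diag_mem_meetingPairs hT p
  · refine Measure.AbsolutelyContinuous.mk fun s _ hs => ?_
    have h3 : 2⁻¹ * (π s + π.map Prod.swap s) + (((ν₀ : Measure (E d × E d)) - ρ).map
      fun p => (p, p)) s = 0 := hs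
    simp only [add_eq_zero, mul_eq_zero] at h3
    exact (h3.1.resolve_left (by norm_num)).1

/-- An initial datum from which no dissipation is possible is concentrated on states whose free
trajectories do not cross. -/
theorem exists_nonCrossing (hT : 0 < T) (hν : ν₀ ∈ D₀ d T) :
    ∃ S : Set (E d × E d), MeasurableSet S ∧ (∀ᵐ p ∂(ν₀ : Measure (E d × E d)), p ∈ S) ∧
      NonCrossing T S := by
  obtain ⟨N, hN, hνN, hcov⟩ := exists_null_cover_of_iUnion_isCompact
    (ν := (ν₀ : Measure (E d × E d))) (K := crossingCompact d T) isCompact_crossingCompact (by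
      intro π hπ hπ0 h1 h2
      have hae : ∀ᵐ z ∂π, z ∈ {z ∈ meetingPairs d T | z.1.2 ≠ z.2.2} := by
        rw [← iUnion_crossingCompact]
        exact hπ0
      obtain ⟨θ, hθ, hac⟩ := exists_isMeetingCoupling hT (hae.mono fun z hz => hz.1) h1 h2
      -- `θ` charges only equal velocities and `π ≪ θ`, whereas `π` lives on different velocities;
      -- hence `π = 0`.
      have hv := hac.ae_le (hθ.ae_eq_velocity hT hν)
      rw [← ae_eq_bot, ← eventually_false_iff_eq_bot]
      filter_upwards [hae, hv] with z h3 h4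
      exact h3.2 h4)
  refine ⟨Nᶜ, hN.compl, measure_eq_zero_iff_ae_notMem.1 hνN, fun p hp q hq hpq t ht heq => ?_⟩
  -- Distinct states that meet have distinct velocities; otherwise their initial positions would
  -- agree as well.
  have hne : p.2 ≠ q.2 := by
    intro h
    rw [h] at heq
    exact hpq (Prod.ext (add_right_cancel heq) h)
  have hm : meetingTime (p, q) = t := meetingTime_eq ht.1 heq hne
  have hmem : (p, q) ∈ ⋃ n, crossingCompact d T n := by
    rw [iUnion_crossingCompact]
    exact ⟨⟨by rw [hm]; exact ht.2, by rw [hm]; exact heq⟩, hne⟩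
  exact (hcov _ hmem).elim hp hq

/-- A measurable set of states without crossings at time `0` is the graph of a measurable
velocity field. -/
lemma NonCrossing.exists_graphOn_eq (hT : 0 < T) {S : Set (E d × E d)} (hS : MeasurableSet S)
    (h : NonCrossing T S) :
    ∃ (A : Set (E d)) (v₀ : E d → E d), MeasurableSet A ∧ Measurable v₀ ∧ A.graphOn v₀ = S := by
  have : StandardBorelSpace S := hS.standardBorel
  -- Non-crossing at time `0` says that the position determines the state; Lusin–Souslin then makes
  -- the projection a measurable embedding.
  have hinj : Function.Injective fun p : S => p.1.1 := by
    intro p q hpq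
    by_contra hne
    refine h p.2 q.2 (fun h' => hne (Subtype.ext h')) 0 ⟨le_rfl, hT⟩ ?_
    simpa using hpq
  have hemb : MeasurableEmbedding fun p : S => p.1.1 :=
    Measurable.measurableEmbedding (by fun_prop) hinj
  obtain ⟨v₀, hv₀, hv⟩ := hemb.exists_measurable_extend (g := fun p : S => p.1.2) (by fun_prop)
    fun _ => ⟨0⟩
  have hv' : ∀ p ∈ S, v₀ p.1 = p.2 := fun p hp => congrFun hv ⟨p, hp⟩
  refine ⟨range fun p : S => p.1.1, v₀, hemb.measurableSet_range, hv₀, ?_⟩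
  ext q
  simp only [mem_graphOn, mem_range, Subtype.exists]
  constructor
  · rintro ⟨⟨p, hp, hpq⟩, hq⟩
    have : p = q := Prod.ext hpq (by rw [← hv' p hp, ← hq, hpq])
    exact this ▸ hp
  · intro hq
    exact ⟨⟨q, hq, rfl⟩, hv' q hq⟩

/-- The pairs of identical particles with law `ν₀`. -/
def diagonalCoupling (ν₀ : ProbabilityMeasure (E d × E d)) : ProbabilityMeasure (StatePair d) :=
  ν₀.map (f := fun p => (p, p)) (by fun_prop)

lemma coe_diagonalCoupling (ν₀ : ProbabilityMeasure (E d × E d)) :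
    (diagonalCoupling ν₀ : Measure (StatePair d)) =
      (ν₀ : Measure (E d × E d)).map fun p => (p, p) := rfl

lemma isMeetingCoupling_diagonalCoupling (hT : 0 < T) (ν₀ : ProbabilityMeasure (E d × E d)) :
    IsMeetingCoupling T (diagonalCoupling ν₀) ν₀ := by
  have hdiag : Measurable fun p : E d × E d => (p, p) := by fun_prop
  refine ⟨?_, ?_, ?_⟩
  · rw [coe_diagonalCoupling, Measure.map_map measurable_swap hdiag]
    rfl
  · rw [coe_diagonalCoupling, Measure.map_map measurable_fst hdiag]
    exact Measure.map_id
  · rw [coe_diagonalCoupling]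
    refine (ae_map_iff (p := fun z => z ∈ meetingPairs d T) hdiag.aemeasurable
      measurableSet_meetingPairs).2 ?_
    exact Eventually.of_forall fun p => diag_mem_meetingPairs hT p

/-- The free flow is concentrated on the lines given by the initial states. -/
lemma ae_line_stickyMeasure_diagonalCoupling {S : Set (E d × E d)} (hS : MeasurableSet S)
    (hν : ∀ᵐ p ∂(ν₀ : Measure (E d × E d)), p ∈ S) :
    ∀ᵐ (γ : Curve d T) ∂(stickyMeasure T (diagonalCoupling ν₀) : Measure (Curve d T)), ∃ p ∈ S,
      ∀ᵐ t ∂timeMeasure T, (γ : L2Curve d T) t = p.1 + t • p.2 := by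
  have hm : Measurable fun p : E d × E d => stickyCurve T (p, p) :=
    (measurable_stickyCurve T).comp (by fun_prop)
  rw [coe_stickyMeasure, coe_diagonalCoupling, Measure.map_map (measurable_stickyCurve T)
    (by fun_prop)]
  filter_upwards [ae_map_exists_preimage hm hS hν] with γ hγ
  obtain ⟨p, hp, rfl⟩ := hγ
  refine ⟨p, hp, ?_⟩
  filter_upwards [stickyCurve_ae_eq T (p, p)] with t ht
  rw [ht, path_diag]

/-- A dissipative solution without dissipation is the free flow. -/
theorem eq_stickyMeasure_diagonalCoupling (hT : 0 < T) (hν : ν₀ ∈ P₂₁ d)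
    {η : ProbabilityMeasure (Curve d T)} (hη : IsDissipative η) (h : HasInitialDatum η ν₀)
    (hD : dissipation η = 0) : η = stickyMeasure T (diagonalCoupling ν₀) := by
  refine Subtype.ext ?_
  change (η : Measure (Curve d T)) = stickyMeasure T (diagonalCoupling ν₀)
  have hm : Measurable (stickyCurve T ∘ fun p : E d × E d => (p, p)) :=
    (measurable_stickyCurve T).comp (by fun_prop)
  rw [coe_stickyMeasure, coe_diagonalCoupling, Measure.map_map (measurable_stickyCurve T)
    (by fun_prop), ← show _ = (ν₀ : Measure (E d × E d)) from h, Measure.map_map hm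
    ((measurable_e₀ hT).prodMk (measurable_W₀ hT))]
  -- Almost every `γ` is the line through its own initial state, so the identity agrees `η`-almost
  -- everywhere with a map factoring through `(e₀, W₀)`.
  conv_lhs => rw [← Measure.map_id (μ := (η : Measure (Curve d T)))]
  refine Measure.map_congr ?_
  filter_upwards [ae_eq_line_of_dissipation_eq_zero hT hη h hν hD] with γ hγ
  refine Subtype.ext (Lp.ext ?_)
  filter_upwards [hγ, stickyCurve_ae_eq T ((e₀ γ, W₀ γ), (e₀ γ, W₀ γ))] with t h1 h2
  exact h1.trans ((path_diag (e₀ γ, W₀ γ) t).symm.trans h2.symm)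

end FreeFlow

end

end PressurelessEuler

theorem mainTheorem7 (d : ℕ) (T : ℝ) (hT : 0 < T)
    (ν₀ : ProbabilityMeasure (PressurelessEuler.E d × PressurelessEuler.E d))
    (hν₀ : ν₀ ∈ PressurelessEuler.D₀ d T) :
    ∃ (A : Set (PressurelessEuler.E d)) (v₀ : PressurelessEuler.E d → PressurelessEuler.E d),
      MeasurableSet A ∧ Measurable v₀ ∧
      (∀ᵐ p ∂(ν₀ : Measure (PressurelessEuler.E d × PressurelessEuler.E d)),
        p ∈ A.graphOn v₀) ∧
      PressurelessEuler.NonCrossing T (A.graphOn v₀) ∧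
      ∃ η : ProbabilityMeasure (PressurelessEuler.Curve d T),
        PressurelessEuler.HasInitialDatum η ν₀ ∧
        PressurelessEuler.IsFreeFlowAlong η (A.graphOn v₀) ∧
        ∀ η' : ProbabilityMeasure (PressurelessEuler.Curve d T),
          PressurelessEuler.IsDissipative η' → PressurelessEuler.HasInitialDatum η' ν₀ →
            η' = η := by
  obtain ⟨S, hS, hνS, hcross⟩ := PressurelessEuler.exists_nonCrossing hT hν₀
  obtain ⟨A, v₀, hA, hv₀, rfl⟩ := hcross.exists_graphOn_eq hT hS
  have hc := PressurelessEuler.isMeetingCoupling_diagonalCoupling hT ν₀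
  exact ⟨A, v₀, hA, hv₀, hνS, hcross, _, hc.hasInitialDatum hT,
    ⟨hc.isDissipative hT hν₀.1, hcross,
      PressurelessEuler.ae_line_stickyMeasure_diagonalCoupling hS hνS⟩,
    fun η' h1 h2 => PressurelessEuler.eq_stickyMeasure_diagonalCoupling hT hν₀.1 h1 h2
      (hν₀.2 η' h1 h2)⟩
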